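/- **Proposition 5.2.** Let $\Omega\subset\mathbb R^m$, $\delta>0$, $l:[0,\infty)\times\mathbb R^n\times\mathbb R^m\to\mathbb R$ and $f:[0,\infty)\times\mathbb R^n\times\mathbb R^m\to\mathbb R^n$. For $\tau\ge 0$ and $z\in\mathbb R^n$ let $\mathcal D_{\tau,z;\infty}$ be the set of pairs $(x,u)$ such that $u\in L^1_{loc}([\tau,\infty);\mathbb R^m)$, $u(t)\in\Omega$ for a.e. $t\ge\tau$, $x(t)=z+\int_\tau^t f(r,x(r),u(r))\,dr$ for all $t\ge\tau$ (with integrable integrand), and the cost $J(u;\tau,z)=\int_\tau^\infty e^{-\delta t}l(t,x(t),u(t))\,dt$ is finite (the integrand is integrable on $(\tau,\infty)$). Assume: * A1) there is $K_1>0$ with $|l(t,x,u)-l(t,z,u)|+|f(t,x,u)-f(t,z,u)|\le K_1|x-z|$ for all $t\ge0$, $u\in\Omega$, $x,z\in\mathbb R^n$; * A2) there is $K_2>0$ with $|l(t,x,u)|+|f(t,x,u)|\le K_2(1+|x|)$ for all $t\ge0$, $x\in\mathbb R^n$, $u\in\Omega$; * A3) $l$ and $f$ are continuous; * A4) $\{(e^{-\delta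 t}l(t,x,v),f(t,x,v)) : v\in\Omega\}$ is convex in $\mathbb R^{1+n}$ for all $t\ge0$, $x\in\mathbb R^n$; * A5) $\Omega$ is compact; * A6) for all $(\tau,z)\in[0,\infty)\times\mathbb R^n$ there is a bounded set $S_{\tau,z}\subset\mathbb R^n$ such that $x(t)\in S_{\tau,z}$ for all $t\ge\tau$ and all $(x,u)\in\mathcal D_{\tau,z;\infty}$; * $\mathcal D_{\tau,z;\infty}\neq\emptyset$ for all $(\tau,z)\in[0,\infty)\times\mathbb R^n$. Let $V(\tau,z)=\inf\{J(u;\tau,z) : (x,u)\in\mathcal D_{\tau,z;\infty}\}$ be the value function and $\mathcal H(t,x,\lambda)=\inf_{u\in\Omega}\{\langle\lambda,f(t,x,u)\rangle+e^{-\delta t}l(t,x,u)\}$. For $\Phi:[0,\infty)\times\mathbb R^n\to\mathbb R$, $(t,x)\in[0,\infty)\times\mathbb R^n$ and $(\alpha,\xi)\in\mathbb R^{1+n}$ put $$D^-\Phi(t,x;\alpha,\xi)=\liminf_{r\downarrow0,\;w\to\xi}\frac{\Phi(t+r\alpha,x+rw)-\Phi(t,x)}{r}\in[-\infty,\infty],$$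 where only $r$ with $t+r\alpha\ge0$ are admitted (so $D^-\Phi(0,x;\alpha,\xi)=+\infty$ for $\alpha<0$), and let $D^+\Phi$ be defined in the same way with $\limsup$ (so $D^+\Phi(0,x;\alpha,\xi)=-\infty$ for $\alpha<0$). Put $$\partial_D\Phi(t,x)=\{(\alpha,\xi) : D^-\Phi(t,x;a,v)\ge a\alpha+\langle v,\xi\rangle\ \ \forall (a,v)\in\mathbb R^{1+n}\},$$ $$\partial^D\Phi(t,x)=\{(\alpha,\xi) : D^+\Phi(t,x;a,v)\le a\alpha+\langle v,\xi\rangle\ \ \forall (a,v)\in\mathbb R^{1+n}\}.$$ A continuous $\Phi:[0,\infty)\times\mathbb R^n\to\mathbb R$ with $\Phi(\tau,\cdot)\to0$ as $\tau\to\infty$, uniformly on each compact subset of $\mathbb R^n$, is a *Dini sub-solution* if $\alpha+\mathcal H(\tau,z,\xi)\ge0$ for all $(\tau,z)\in[0,\infty)\times\mathbb R^n$ and $(\alpha,\xi)\in\partial^D\Phi(\tau,z)$, and a *Dini super-solution* if $\alpha+\mathcal H(\tau,z,\xi)\le0$ for all $(\tau,z)\in[0,\infty)\times\mathbb R^n$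 and $(\alpha,\xi)\in\partial_D\Phi(\tau,z)$. Then for every $(s,z)\in[0,\infty)\times\mathbb R^n$ the infimum $V(s,z)$ is finite, $V(s,z)\ge\Phi(s,z)$ for every Dini sub-solution $\Phi$, and $V(s,z)\le\Phi(s,z)$ for every Dini super-solution $\Phi$. -/

import Mathlib

open Set Filter Topology MeasureTheory

/-- The data of a discounted infinite horizon control problem with state space `ℝⁿ` and controls
in `ℝᵐ`: discount rate `δ`, control set `Ω`, running cost `l` and dynamics `f`. Only the values of
`l` and `f` at times `t ≥ 0` are ever used. -/
structure ControlProblem (n m : ℕ) where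
  δ : ℝ
  Ω : Set (EuclideanSpace ℝ (Fin m))
  l : ℝ → EuclideanSpace ℝ (Fin n) → EuclideanSpace ℝ (Fin m) → ℝ
  f : ℝ → EuclideanSpace ℝ (Fin n) → EuclideanSpace ℝ (Fin m) → EuclideanSpace ℝ (Fin n)

namespace ControlProblem

variable {n m : ℕ}

/-- `U_ad[τ, ∞)`: locally integrable controls on `[τ, ∞)` with values a.e. in `Ω`. -/
def IsAdmissibleControl (P : ControlProblem n m) (τ : ℝ)
    (u : ℝ → EuclideanSpace ℝ (Fin m)) : Prop :=
  LocallyIntegrableOn u (Ici τ) ∧ ∀ᵐ t ∂(volume.restrict (Ici τ)), u t ∈ P.Ω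

/-- `x` is the state trajectory on `[τ, ∞)` for the control `u` with initial value `x(τ) = z`,
i.e. `x(t) = z + ∫_τ^t f(r, x(r), u(r)) dr` for `t ≥ τ`, the integrand being integrable
(so that `x` is locally absolutely continuous on `[τ, ∞)`). -/
def IsTrajectory (P : ControlProblem n m) (τ : ℝ) (z : EuclideanSpace ℝ (Fin n))
    (x : ℝ → EuclideanSpace ℝ (Fin n)) (u : ℝ → EuclideanSpace ℝ (Fin m)) : Prop :=
  ∀ t, τ ≤ t → IntervalIntegrable (fun r => P.f r (x r) (u r)) volume τ t ∧
    x t = z + ∫ r in τ..t, P.f r (x r) (u r)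

/-- The discounted running cost `t ↦ e^{-δ t} l(t, x(t), u(t))` along a pair `(x, u)`. -/
noncomputable def runningCost (P : ControlProblem n m)
    (p : (ℝ → EuclideanSpace ℝ (Fin n)) × (ℝ → EuclideanSpace ℝ (Fin m))) (t : ℝ) : ℝ :=
  Real.exp (-P.δ * t) * P.l t (p.1 t) (p.2 t)

/-- The cost `J = ∫_τ^∞ e^{-δ t} l(t, x(t), u(t)) dt` of a pair `(x, u)`. -/
noncomputable def cost (P : ControlProblem n m) (τ : ℝ)
    (p : (ℝ → EuclideanSpace ℝ (Fin n)) × (ℝ → EuclideanSpace ℝ (Fin m))) : ℝ :=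
  ∫ t in Ioi τ, P.runningCost p t

/-- `𝒟_{τ,z;∞}`: the admissible processes `(x, u)` issuing from `(τ, z)` with finite cost. -/
def processes (P : ControlProblem n m) (τ : ℝ) (z : EuclideanSpace ℝ (Fin n)) :
    Set ((ℝ → EuclideanSpace ℝ (Fin n)) × (ℝ → EuclideanSpace ℝ (Fin m))) :=
  {p | P.IsAdmissibleControl τ p.2 ∧ P.IsTrajectory τ z p.1 p.2 ∧
    IntegrableOn (P.runningCost p) (Ioi τ)}

/-- The value function `V(τ, z)`, the infimum of the costs over `𝒟_{τ,z;∞}`. -/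
noncomputable def value (P : ControlProblem n m) (τ : ℝ) (z : EuclideanSpace ℝ (Fin n)) : ℝ :=
  sInf (P.cost τ '' P.processes τ z)

/-- The Hamiltonian `ℋ(t, x, λ) = inf_{u ∈ Ω} (⟨λ, f(t, x, u)⟩ + e^{-δ t} l(t, x, u))`. -/
noncomputable def hamiltonian (P : ControlProblem n m) (t : ℝ)
    (x lam : EuclideanSpace ℝ (Fin n)) : ℝ :=
  sInf ((fun u => inner ℝ lam (P.f t x u) + Real.exp (-P.δ * t) * P.l t x u) '' P.Ω)

end ControlProblem

section Dini

variable {n : ℕ}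

/-- The filter `r ↓ 0, w → ξ`, restricted to those `r` for which `t + r α` stays in the time domain
`[0, ∞)`. The restriction is void for `t > 0`, and also for `t = 0 ≤ α`; for `t = 0 > α` the filter
is trivial (the direction points out of the domain). -/
def diniFilter (t α : ℝ) (ξ : EuclideanSpace ℝ (Fin n)) :
    Filter (ℝ × EuclideanSpace ℝ (Fin n)) :=
  (𝓝[>] (0 : ℝ) ×ˢ 𝓝 ξ) ⊓ 𝓟 {p | 0 ≤ t + p.1 * α}

/-- The difference quotient `(Φ(t + r α, x + r w) - Φ(t, x)) / r`, as a function of `(r, w)`. -/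
noncomputable def diniQuotient (Φ : ℝ → EuclideanSpace ℝ (Fin n) → ℝ) (t : ℝ)
    (x : EuclideanSpace ℝ (Fin n)) (α : ℝ) (p : ℝ × EuclideanSpace ℝ (Fin n)) : EReal :=
  (((Φ (t + p.1 * α) (x + p.1 • p.2) - Φ t x) / p.1 : ℝ) : EReal)

/-- The lower Dini derivative `D⁻Φ(t, x; α, ξ)` of a function on `[0, ∞) × ℝⁿ`, with values in
`[-∞, ∞]`. It is `+∞` in directions pointing out of the domain. -/
noncomputable def lowerDini (Φ : ℝ → EuclideanSpace ℝ (Fin n) → ℝ) (t : ℝ)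
    (x : EuclideanSpace ℝ (Fin n)) (α : ℝ) (ξ : EuclideanSpace ℝ (Fin n)) : EReal :=
  liminf (diniQuotient Φ t x α) (diniFilter t α ξ)

/-- The upper Dini derivative `D⁺Φ(t, x; α, ξ)` of a function on `[0, ∞) × ℝⁿ`, with values in
`[-∞, ∞]`. It is `-∞` in directions pointing out of the domain. -/
noncomputable def upperDini (Φ : ℝ → EuclideanSpace ℝ (Fin n) → ℝ) (t : ℝ)
    (x : EuclideanSpace ℝ (Fin n)) (α : ℝ) (ξ : EuclideanSpace ℝ (Fin n)) : EReal :=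
  limsup (diniQuotient Φ t x α) (diniFilter t α ξ)

/-- The Dini sub-gradient `∂_D Φ(t, x)`. -/
def diniSubgradient (Φ : ℝ → EuclideanSpace ℝ (Fin n) → ℝ) (t : ℝ)
    (x : EuclideanSpace ℝ (Fin n)) : Set (ℝ × EuclideanSpace ℝ (Fin n)) :=
  {q | ∀ (a : ℝ) (v : EuclideanSpace ℝ (Fin n)),
    ((a * q.1 + inner ℝ v q.2 : ℝ) : EReal) ≤ lowerDini Φ t x a v}

/-- The Dini super-gradient `∂^D Φ(t, x)`. -/
def diniSupergradient (Φ : ℝ → EuclideanSpace ℝ (Fin n) → ℝ) (t : ℝ)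
    (x : EuclideanSpace ℝ (Fin n)) : Set (ℝ × EuclideanSpace ℝ (Fin n)) :=
  {q | ∀ (a : ℝ) (v : EuclideanSpace ℝ (Fin n)),
    upperDini Φ t x a v ≤ ((a * q.1 + inner ℝ v q.2 : ℝ) : EReal)}

/-- The decay condition: `Φ(τ, ·) → 0` as `τ → ∞`, uniformly on each compact subset of `ℝⁿ`. -/
def DecaysAtInfinity (Φ : ℝ → EuclideanSpace ℝ (Fin n) → ℝ) : Prop :=
  ∀ K : Set (EuclideanSpace ℝ (Fin n)), IsCompact K →
    TendstoUniformlyOn Φ (fun _ => (0 : ℝ)) atTop K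

end Dini

namespace ControlProblem

variable {n m : ℕ}

/-- Dini sub-solutions of `∂_t v + ℋ(t, x, ∂_x v) = 0`. The function `Φ` is meant as a function on
`[0, ∞) × ℝⁿ`; its values at negative times play no role. -/
structure IsDiniSubsolution (P : ControlProblem n m)
    (Φ : ℝ → EuclideanSpace ℝ (Fin n) → ℝ) : Prop where
  continuousOn : ContinuousOn (fun p : ℝ × EuclideanSpace ℝ (Fin n) => Φ p.1 p.2) (Ici 0 ×ˢ univ)
  hjb : ∀ τ : ℝ, 0 ≤ τ → ∀ z : EuclideanSpace ℝ (Fin n), ∀ q ∈ diniSupergradient Φ τ z,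
    0 ≤ q.1 + P.hamiltonian τ z q.2
  decay : DecaysAtInfinity Φ

/-- Dini super-solutions of `∂_t v + ℋ(t, x, ∂_x v) = 0`. -/
structure IsDiniSupersolution (P : ControlProblem n m)
    (Φ : ℝ → EuclideanSpace ℝ (Fin n) → ℝ) : Prop where
  continuousOn : ContinuousOn (fun p : ℝ × EuclideanSpace ℝ (Fin n) => Φ p.1 p.2) (Ici 0 ×ˢ univ)
  hjb : ∀ τ : ℝ, 0 ≤ τ → ∀ z : EuclideanSpace ℝ (Fin n), ∀ q ∈ diniSubgradient Φ τ z,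
    q.1 + P.hamiltonian τ z q.2 ≤ 0
  decay : DecaysAtInfinity Φ

end ControlProblem

/-! Both inequalities replace Φ by a quadratic sup-convolution over a compact cylinder: of Φ for a
sub-solution, of -Φ for a super-solution. The penalty gradient at a maximiser yields a Dini gradient
of Φ, where the Hamilton-Jacobi inequality applies. By `exists_penalty` the weights can be chosen so
that moving this inequality from the maximiser back to the centre costs at most θ.

Sub-solution: along a process (x, u) the sup-convolution M is Lipschitz in time, and M' ≥ -e^{-δt} l
- θ almost everywhere (`neg_discountedCost_le_deriv`). Integrating over [s, T] bounds Φ(s, z) ≤ M(s)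
by the cost up to T plus M(T) + θ(T - s).

Super-solution: let W be the sup-convolution of -Φ. At a maximiser some control is nearly optimal;
frozen for a short time h, it costs at most the increment of W plus 5θh (`exists_isArc_step`). The
admissible h is uniform, so finitely many steps reach T (`exists_process`), and -W(s, z) ≤ Φ(s, z).

In both cases decay of Φ makes the value at T small and discounting makes the cost after T small
(`exists_horizon`). -/

/-! ### Test functions touching from one side give Dini gradients. -/

section Touching

variable {n : ℕ}

lemma tendsto_diniFilter_nhdsWithin (t a : ℝ) (x v : EuclideanSpace ℝ (Fin n)) :
    Tendsto (fun p : ℝ × EuclideanSpace ℝ (Fin n) => (t + p.1 * a, x + p.1 • p.2))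
      (diniFilter t a v) (𝓝[Ici 0 ×ˢ univ] (t, x)) := by
  refine tendsto_nhdsWithin_iff.2 ⟨?_, ?_⟩
  · have h : Tendsto (fun p : ℝ × EuclideanSpace ℝ (Fin n) => (t + p.1 * a, x + p.1 • p.2))
        (𝓝 (0, v)) (𝓝 (t + 0 * a, x + (0 : ℝ) • v)) := by
      apply Continuous.tendsto (f := fun p : ℝ × EuclideanSpace ℝ (Fin n) =>
        (t + p.1 * a, x + p.1 • p.2)) (x := (0, v))
      fun_prop
    simp only [zero_mul, add_zero, zero_smul] at h
    refine h.mono_left (inf_le_left.trans ?_)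
    rw [nhds_prod_eq]
    exact Filter.prod_mono nhdsWithin_le_nhds le_rfl
  · filter_upwards [mem_inf_of_right (mem_principal_self {p : ℝ × EuclideanSpace ℝ (Fin n) |
      0 ≤ t + p.1 * a})] with p hp
    exact ⟨hp, trivial⟩

lemma eventually_pos_diniFilter (t a : ℝ) (v : EuclideanSpace ℝ (Fin n)) :
    ∀ᶠ p in diniFilter t a v, 0 < p.1 := by
  have h : ∀ᶠ p in (𝓝[>] (0 : ℝ) ×ˢ 𝓝 v), 0 < p.1 :=
    tendsto_fst.eventually self_mem_nhdsWithin
  exact h.filter_mono inf_le_left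

/-- The derivative at a single point already controls quotients with varying directions. Since F is
differentiable in the full space, the boundary t = 0 needs no separate treatment. -/
lemma HasFDerivAt.tendsto_dini_quotient {F : ℝ × EuclideanSpace ℝ (Fin n) → ℝ}
    {F' : ℝ × EuclideanSpace ℝ (Fin n) →L[ℝ] ℝ} {t : ℝ} {x : EuclideanSpace ℝ (Fin n)}
    (hF : HasFDerivAt F F' (t, x)) (a : ℝ) (v : EuclideanSpace ℝ (Fin n)) :
    Tendsto (fun p : ℝ × EuclideanSpace ℝ (Fin n) =>
      (F (t + p.1 * a, x + p.1 • p.2) - F (t, x)) / p.1) (diniFilter t a v) (𝓝 (F' (a, v))) := by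
  have hd : Tendsto (fun p : ℝ × EuclideanSpace ℝ (Fin n) => (p.1 * a, p.1 • p.2))
      (diniFilter t a v) (𝓝 0) := by
    have h := (tendsto_diniFilter_nhdsWithin t a x v).mono_right nhdsWithin_le_nhds
    have h2 := h.sub_const (t, x)
    simpa using! h2
  have hcd : Tendsto (fun p : ℝ × EuclideanSpace ℝ (Fin n) => p.1⁻¹ • (p.1 * a, p.1 • p.2))
      (diniFilter t a v) (𝓝 (a, v)) := by
    have h1 : Tendsto (fun p : ℝ × EuclideanSpace ℝ (Fin n) => (a, p.2))
        (diniFilter t a v) (𝓝 (a, v)) := by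
      rw [nhds_prod_eq]
      exact tendsto_const_nhds.prodMk (tendsto_snd.mono_left inf_le_left)
    refine h1.congr' ?_
    filter_upwards [eventually_pos_diniFilter t a v] with p hp
    simp [smul_smul, ← mul_assoc, inv_mul_cancel₀ hp.ne']
  have := hF.hasFDerivWithinAt (s := univ) |>.lim hd (by simp) hcd
  refine this.congr' (Eventually.of_forall fun p => ?_)
  simp [div_eq_inv_mul]

/-- Difference quotients of Φ are dominated by those of F. Differentiability at the touching point
alone is required because the test functions will be built from trajectories, which are only a.e.
differentiable; comparison inside the time domain alone allows touching at t = 0. -/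
lemma mem_diniSupergradient_of_eventually_le {Φ : ℝ → EuclideanSpace ℝ (Fin n) → ℝ}
    {F : ℝ × EuclideanSpace ℝ (Fin n) → ℝ} {F' : ℝ × EuclideanSpace ℝ (Fin n) →L[ℝ] ℝ}
    {t : ℝ} {x : EuclideanSpace ℝ (Fin n)} {α : ℝ} {ξ : EuclideanSpace ℝ (Fin n)}
    (hF : HasFDerivAt F F' (t, x)) (hF' : ∀ a v, F' (a, v) = a * α + inner ℝ v ξ)
    (heq : Φ t x = F (t, x))
    (hle : ∀ᶠ q in 𝓝[Ici 0 ×ˢ univ] (t, x), Φ q.1 q.2 ≤ F q) :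
    (α, ξ) ∈ diniSupergradient Φ t x := by
  intro a v
  -- For directions leaving the time domain the filter is trivial and the limsup is ⊥.
  rcases eq_or_neBot (diniFilter t a v) with h | h
  · simp [upperDini, h]
  have ht := (continuous_coe_real_ereal.tendsto _).comp (hF.tendsto_dini_quotient a v)
  rw [upperDini, ← hF' a v, ← ht.limsup_eq]
  refine limsup_le_limsup ?_
  filter_upwards [(tendsto_diniFilter_nhdsWithin t a x v).eventually hle,
    eventually_pos_diniFilter t a v] with p hp hp0
  simp only [diniQuotient, Function.comp_apply, EReal.coe_le_coe_iff, heq]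
  gcongr

lemma mem_diniSubgradient_of_eventually_le {Φ : ℝ → EuclideanSpace ℝ (Fin n) → ℝ}
    {F : ℝ × EuclideanSpace ℝ (Fin n) → ℝ} {F' : ℝ × EuclideanSpace ℝ (Fin n) →L[ℝ] ℝ}
    {t : ℝ} {x : EuclideanSpace ℝ (Fin n)} {α : ℝ} {ξ : EuclideanSpace ℝ (Fin n)}
    (hF : HasFDerivAt F F' (t, x)) (hF' : ∀ a v, F' (a, v) = a * α + inner ℝ v ξ)
    (heq : Φ t x = F (t, x))
    (hle : ∀ᶠ q in 𝓝[Ici 0 ×ˢ univ] (t, x), F q ≤ Φ q.1 q.2) :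
    (α, ξ) ∈ diniSubgradient Φ t x := by
  intro a v
  rcases eq_or_neBot (diniFilter t a v) with h | h
  · simp [lowerDini, h]
  have ht := (continuous_coe_real_ereal.tendsto _).comp (hF.tendsto_dini_quotient a v)
  rw [lowerDini, ← hF' a v, ← ht.liminf_eq]
  refine liminf_le_liminf ?_
  filter_upwards [(tendsto_diniFilter_nhdsWithin t a x v).eventually hle,
    eventually_pos_diniFilter t a v] with p hp hp0
  simp only [diniQuotient, Function.comp_apply, EReal.coe_le_coe_iff, heq]
  gcongr

end Touching

/-! ### Sup-convolutions and the choice of penalty weights. -/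

section Penalization

variable {E : Type*} [NormedAddCommGroup E]

/-- `Ψ` minus the quadratic penalty centred at `(t, y)`. -/
noncomputable def penalized (Ψ : ℝ → E → ℝ) (b c t : ℝ) (y : E) (q : ℝ × E) : ℝ :=
  Ψ q.1 q.2 - c / 2 * (q.1 - t) ^ 2 - b / 2 * ‖q.2 - y‖ ^ 2

/-- The compact cylinder `[0, T] × B(0, R)`. -/
def timeCylinder (E : Type*) [NormedAddCommGroup E] (T R : ℝ) : Set (ℝ × E) :=
  Icc 0 T ×ˢ Metric.closedBall 0 R

/-- The quadratic sup-convolution of `Ψ` over the cylinder `[0, T] × B(0, R)`. -/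
noncomputable def supConv (Ψ : ℝ → E → ℝ) (T R b c t : ℝ) (y : E) : ℝ :=
  sSup (penalized Ψ b c t y '' timeCylinder E T R)

lemma mem_timeCylinder_iff {T R : ℝ} {q : ℝ × E} :
    q ∈ timeCylinder E T R ↔ (0 ≤ q.1 ∧ q.1 ≤ T) ∧ ‖q.2‖ ≤ R := by
  simp [timeCylinder]

lemma isCompact_timeCylinder [ProperSpace E] (T R : ℝ) : IsCompact (timeCylinder E T R) :=
  isCompact_Icc.prod (isCompact_closedBall _ _)

lemma timeCylinder_subset (T R : ℝ) : timeCylinder E T R ⊆ Ici 0 ×ˢ univ :=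
  prod_mono Icc_subset_Ici_self (subset_univ _)

lemma continuousOn_penalized {Ψ : ℝ → E → ℝ}
    (hΨ : ContinuousOn (fun q : ℝ × E => Ψ q.1 q.2) (Ici 0 ×ˢ univ)) (T R b c t : ℝ) (y : E) :
    ContinuousOn (penalized Ψ b c t y) (timeCylinder E T R) := by
  unfold penalized
  have := hΨ.mono (timeCylinder_subset T R)
  fun_prop

lemma exists_supConv_eq [ProperSpace E] {Ψ : ℝ → E → ℝ}
    (hΨ : ContinuousOn (fun q : ℝ × E => Ψ q.1 q.2) (Ici 0 ×ˢ univ)) {T R : ℝ} (hT : 0 ≤ T)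
    (hR : 0 ≤ R) (b c t : ℝ) (y : E) :
    ∃ q ∈ timeCylinder E T R, supConv Ψ T R b c t y = penalized Ψ b c t y q ∧
      ∀ q' ∈ timeCylinder E T R, penalized Ψ b c t y q' ≤ penalized Ψ b c t y q :=
  (isCompact_timeCylinder T R).exists_sSup_image_eq_and_ge
    ⟨(0, 0), mem_timeCylinder_iff.2 ⟨⟨le_rfl, hT⟩, by simpa⟩⟩ (continuousOn_penalized hΨ T R b c t y)

lemma penalized_le_supConv [ProperSpace E] {Ψ : ℝ → E → ℝ}
    (hΨ : ContinuousOn (fun q : ℝ × E => Ψ q.1 q.2) (Ici 0 ×ˢ univ)) {T R : ℝ} (b c t : ℝ) (y : E)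
    {q : ℝ × E} (hq : q ∈ timeCylinder E T R) :
    penalized Ψ b c t y q ≤ supConv Ψ T R b c t y :=
  le_csSup ((isCompact_timeCylinder T R).image_of_continuousOn
    (continuousOn_penalized hΨ T R b c t y)).bddAbove (mem_image_of_mem _ hq)

lemma le_supConv [ProperSpace E] {Ψ : ℝ → E → ℝ}
    (hΨ : ContinuousOn (fun q : ℝ × E => Ψ q.1 q.2) (Ici 0 ×ˢ univ)) {T R : ℝ} (b c : ℝ)
    {t : ℝ} {y : E} (h : (t, y) ∈ timeCylinder E T R) :
    Ψ t y ≤ supConv Ψ T R b c t y := by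
  simpa [penalized] using penalized_le_supConv hΨ b c t y h

/-- A maximiser beats the centre, so the penalty is at most an oscillation of Ψ. This first makes
the maximiser close, and then, by uniform continuity, makes b‖q.2 - y‖² itself small, which absorbs
the Lipschitz error of F in space. The error of F in time carries a factor b‖q.2 - y‖, so the time
weight c is chosen after b. -/
lemma exists_penalty [InnerProductSpace ℝ E] [ProperSpace E] {U : Type*} [PseudoMetricSpace U] {Ω : Set U}
    (hΩ : IsCompact Ω)
    {Ψ : ℝ → E → ℝ} (hΨ : ContinuousOn (fun q : ℝ × E => Ψ q.1 q.2) (Ici 0 ×ˢ univ))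
    {F : ℝ → E → U → E}
    (hF : ContinuousOn (fun q : ℝ × E × U => F q.1 q.2.1 q.2.2) (Ici 0 ×ˢ univ))
    {L : ℝ → E → U → ℝ}
    (hL : ContinuousOn (fun q : ℝ × E × U => L q.1 q.2.1 q.2.2) (Ici 0 ×ˢ univ))
    {K : ℝ} (hK : 0 < K)
    (hFK : ∀ t, 0 ≤ t → ∀ u ∈ Ω, ∀ x z, ‖F t x u - F t z u‖ ≤ K * ‖x - z‖)
    (T R : ℝ) {θ : ℝ} (hθ : 0 < θ) :
    ∃ b c : ℝ, 0 < b ∧ 0 < c ∧ ∀ t ∈ Icc 0 T, ∀ y : E, ‖y‖ ≤ R →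
      ∀ q ∈ timeCylinder E (T + 1) (R + 1),
      (∀ q' ∈ timeCylinder E (T + 1) (R + 1), penalized Ψ b c t y q' ≤ penalized Ψ b c t y q) →
      |q.1 - t| ≤ θ ∧ ‖q.2 - y‖ ≤ θ ∧
      ∀ u ∈ Ω, |b * inner ℝ (q.2 - y) (F q.1 q.2 u - F t y u)| + |L q.1 q.2 u - L t y u| ≤ θ := by
  set C := timeCylinder E (T + 1) (R + 1) with hC
  have hCc : IsCompact C := isCompact_timeCylinder _ _
  have hΨC := hΨ.mono (timeCylinder_subset (E := E) (T + 1) (R + 1))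
  obtain ⟨M, hM⟩ := hCc.exists_bound_of_continuousOn hΨC
  have hΨu := hCc.uniformContinuousOn_of_continuous hΨC
  set D : Set (ℝ × E × U) := Icc 0 (T + 1) ×ˢ (Metric.closedBall 0 (R + 1) ×ˢ Ω) with hD
  have hDc : IsCompact D := isCompact_Icc.prod ((isCompact_closedBall _ _).prod hΩ)
  have hDs : D ⊆ Ici 0 ×ˢ univ := prod_mono Icc_subset_Ici_self (subset_univ _)
  have hFu := hDc.uniformContinuousOn_of_continuous (hF.mono hDs)
  have hLu := hDc.uniformContinuousOn_of_continuous (hL.mono hDs)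
  rw [Metric.uniformContinuousOn_iff] at hΨu hFu hLu
  obtain ⟨ρ₁, hρ₁, h₁⟩ := hΨu (θ / (6 * K)) (by positivity)
  obtain ⟨ρ₂, hρ₂, h₂⟩ := hLu (θ / 3) (by positivity)
  set ρ := min (min ρ₁ ρ₂) θ with hρdef
  have hρ : 0 < ρ := by positivity
  have hρ1 : ρ ≤ ρ₁ := (min_le_left _ _).trans (min_le_left _ _)
  have hρ2 : ρ ≤ ρ₂ := (min_le_left _ _).trans (min_le_right _ _)
  have hρθ : ρ ≤ θ := min_le_right _ _
  -- Comparison with the centre bounds c(q.1 - t)² + b‖q.2 - y‖² by 4M < A; hence weights A / ρ² and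
  -- A / σ² force distances below ρ and σ.
  set A := 4 * |M| + 1 with hA
  have hA0 : 0 < A := by positivity
  set b := A / ρ ^ 2 with hb
  have hb0 : 0 < b := by positivity
  -- The tolerance compensates the factor bρ bounding the penalty gradient, with b already fixed.
  obtain ⟨ρ₃, hρ₃, h₃⟩ := hFu (θ / (3 * (b * ρ))) (by positivity)
  set σ := min ρ ρ₃ with hσdef
  have hσ : 0 < σ := by positivity
  refine ⟨b, A / σ ^ 2, hb0, by positivity, ?_⟩
  intro t ht y hy q hq hmax
  have hty : (t, y) ∈ C := mem_timeCylinder_iff.2 ⟨⟨ht.1, by linarith [ht.2]⟩, by simp; linarith⟩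
  have hm := hmax _ hty
  simp only [penalized, sub_self, norm_zero] at hm
  have hM1 := hM _ hty
  have hM2 := hM _ hq
  simp only [Real.norm_eq_abs] at hM1 hM2
  have hMM := le_abs_self M
  have hc0 : 0 ≤ A / σ ^ 2 * (q.1 - t) ^ 2 := by positivity
  have hd0 : 0 ≤ b * ‖q.2 - y‖ ^ 2 := by positivity
  have e1 : A / σ ^ 2 * (q.1 - t) ^ 2 < A := by
    rw [abs_le] at hM1 hM2; linarith
  have e2 : b * ‖q.2 - y‖ ^ 2 < A := by
    rw [abs_le] at hM1 hM2; linarith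
  have f1 : |q.1 - t| < σ := by
    rw [div_mul_eq_mul_div, div_lt_iff₀ (by positivity)] at e1
    exact abs_lt_of_sq_lt_sq (lt_of_mul_lt_mul_left e1 hA0.le) hσ.le
  have f2 : ‖q.2 - y‖ < ρ := by
    rw [hb, div_mul_eq_mul_div, div_lt_iff₀ (by positivity)] at e2
    exact lt_of_pow_lt_pow_left₀ 2 hρ.le (lt_of_mul_lt_mul_left e2 hA0.le)
  have hσρ : σ ≤ ρ := min_le_left _ _
  refine ⟨by linarith, by linarith, fun u hu => ?_⟩
  have g1 := h₁ q hq (t, y) hty (by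
    rw [Prod.dist_eq, Real.dist_eq, dist_eq_norm]; exact max_lt (by linarith) (by linarith))
  have hqD : (q.1, q.2, u) ∈ D := ⟨hq.1, hq.2, hu⟩
  have htD : (t, y, u) ∈ D := ⟨hty.1, hty.2, hu⟩
  have htD' : (t, q.2, u) ∈ D := ⟨hty.1, hq.2, hu⟩
  have g2 := h₂ _ hqD _ htD (by
    rw [Prod.dist_eq, Prod.dist_eq, Real.dist_eq, dist_eq_norm, dist_self]
    exact max_lt (by dsimp; linarith) (max_lt (by dsimp; linarith) hρ₂))
  have g3 := h₃ _ hqD _ htD' (by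
    rw [Prod.dist_eq, Prod.dist_eq, Real.dist_eq, dist_self, dist_self]
    exact max_lt (f1.trans_le (min_le_right _ _)) (max_lt hρ₃ hρ₃))
  have g4 := hFK t ht.1 u hu q.2 y
  rw [Real.dist_eq] at g1 g2
  rw [dist_eq_norm] at g3
  -- Second use of maximality: the crude bound A is replaced by twice the modulus of continuity of
  -- Ψ.
  have i1 : b * ‖q.2 - y‖ ^ 2 ≤ θ / (3 * K) := by
    have : θ / (3 * K) = 2 * (θ / (6 * K)) := by field_simp; norm_num
    rw [abs_lt] at g1
    dsimp only at g1
    linarith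
  have i2 : b * (‖q.2 - y‖ * (K * ‖q.2 - y‖)) ≤ θ / 3 := by
    calc b * (‖q.2 - y‖ * (K * ‖q.2 - y‖)) = K * (b * ‖q.2 - y‖ ^ 2) := by ring
      _ ≤ K * (θ / (3 * K)) := by gcongr
      _ = θ / 3 := by field_simp
  have i3 : b * (‖q.2 - y‖ * ‖F q.1 q.2 u - F t q.2 u‖) ≤ θ / 3 := by
    calc _ ≤ b * (ρ * (θ / (3 * (b * ρ)))) := by gcongr
      _ = θ / 3 := by field_simp
  have i4 : |b * inner ℝ (q.2 - y) (F q.1 q.2 u - F t y u)| ≤ θ / 3 + θ / 3 := by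
    rw [abs_mul, abs_of_pos hb0]
    calc _ ≤ b * (‖q.2 - y‖ * ‖F q.1 q.2 u - F t y u‖) := by
          gcongr; exact abs_real_inner_le_norm _ _
      _ ≤ b * (‖q.2 - y‖ * (‖F q.1 q.2 u - F t q.2 u‖ + K * ‖q.2 - y‖)) := by
          gcongr
          calc _ = ‖(F q.1 q.2 u - F t q.2 u) + (F t q.2 u - F t y u)‖ := by congr 1; abel
            _ ≤ _ := (norm_add_le _ _).trans (by gcongr)
      _ ≤ _ := by rw [mul_add, mul_add]; linarith
  linarith

end Penalization

/-! ### Cost and speed bounds along processes. -/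

namespace ControlProblem

variable {n m : ℕ}

/-- The standing assumptions on a discounted control problem, apart from the convexity of the
extended velocity sets and the boundedness of the trajectories. -/
structure IsRegular (P : ControlProblem n m) (K₁ K₂ : ℝ) : Prop where
  discount_pos : 0 < P.δ
  lipschitz_pos : 0 < K₁
  growth_pos : 0 < K₂
  lipschitz : ∀ t : ℝ, 0 ≤ t → ∀ u ∈ P.Ω, ∀ x z : EuclideanSpace ℝ (Fin n),
    ‖P.f t x u - P.f t z u‖ ≤ K₁ * ‖x - z‖
  norm_f_le : ∀ t : ℝ, 0 ≤ t → ∀ x : EuclideanSpace ℝ (Fin n), ∀ u ∈ P.Ω,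
    ‖P.f t x u‖ ≤ K₂ * (1 + ‖x‖)
  abs_l_le : ∀ t : ℝ, 0 ≤ t → ∀ x : EuclideanSpace ℝ (Fin n), ∀ u ∈ P.Ω,
    |P.l t x u| ≤ K₂ * (1 + ‖x‖)
  continuousOn_l : ContinuousOn
    (fun q : ℝ × EuclideanSpace ℝ (Fin n) × EuclideanSpace ℝ (Fin m) => P.l q.1 q.2.1 q.2.2)
    (Ici 0 ×ˢ univ)
  continuousOn_f : ContinuousOn
    (fun q : ℝ × EuclideanSpace ℝ (Fin n) × EuclideanSpace ℝ (Fin m) => P.f q.1 q.2.1 q.2.2)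
    (Ici 0 ×ˢ univ)
  isCompact : IsCompact P.Ω

/-- The discounted running cost `e^{-δ t} l(t, x, u)` as a function of `(t, x, u)`. -/
noncomputable def discountedCost (P : ControlProblem n m) (t : ℝ)
    (x : EuclideanSpace ℝ (Fin n)) (u : EuclideanSpace ℝ (Fin m)) : ℝ :=
  Real.exp (-P.δ * t) * P.l t x u

lemma runningCost_eq (P : ControlProblem n m)
    (p : (ℝ → EuclideanSpace ℝ (Fin n)) × (ℝ → EuclideanSpace ℝ (Fin m))) (t : ℝ) :
    P.runningCost p t = P.discountedCost t (p.1 t) (p.2 t) := rfl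

section Bounds

variable {P : ControlProblem n m} {K₁ K₂ : ℝ}

lemma IsRegular.continuousOn_discountedCost (hP : P.IsRegular K₁ K₂) : ContinuousOn
    (fun q : ℝ × EuclideanSpace ℝ (Fin n) × EuclideanSpace ℝ (Fin m) =>
      P.discountedCost q.1 q.2.1 q.2.2) (Ici 0 ×ˢ univ) := by
  unfold discountedCost
  have := hP.continuousOn_l
  fun_prop

lemma IsRegular.abs_discountedCost_le (hP : P.IsRegular K₁ K₂) {t : ℝ} (ht : 0 ≤ t)
    (x : EuclideanSpace ℝ (Fin n)) {u : EuclideanSpace ℝ (Fin m)} (hu : u ∈ P.Ω) {R : ℝ}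
    (hx : ‖x‖ ≤ R) : |P.discountedCost t x u| ≤ K₂ * (1 + R) * Real.exp (-P.δ * t) := by
  rw [discountedCost, abs_mul, Real.abs_exp, mul_comm]
  have := hP.growth_pos
  gcongr
  exact (hP.abs_l_le t ht x u hu).trans (by gcongr)

variable {s R : ℝ} {z : EuclideanSpace ℝ (Fin n)}
  {p : (ℝ → EuclideanSpace ℝ (Fin n)) × (ℝ → EuclideanSpace ℝ (Fin m))}

lemma ae_mem_of_mem_processes (hp : p ∈ P.processes s z) :
    ∀ᵐ t, s ≤ t → p.2 t ∈ P.Ω :=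
  (ae_restrict_iff' measurableSet_Ici).1 hp.1.2

lemma IsRegular.abs_setIntegral_runningCost_le (hP : P.IsRegular K₁ K₂) (hs : 0 ≤ s)
    (hp : p ∈ P.processes s z) (hR : ∀ t, s ≤ t → ‖p.1 t‖ ≤ R) {T : ℝ} (hT : s ≤ T) :
    |∫ t in Ioi T, P.runningCost p t| ≤ K₂ * (1 + R) / P.δ * Real.exp (-P.δ * T) := by
  have hδ := hP.discount_pos
  calc |∫ t in Ioi T, P.runningCost p t|
      ≤ ∫ t in Ioi T, K₂ * (1 + R) * Real.exp (-P.δ * t) := by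
        rw [← Real.norm_eq_abs]
        refine norm_integral_le_of_norm_le
          ((integrableOn_exp_mul_Ioi (by linarith) T).const_mul _) ?_
        rw [ae_restrict_iff' measurableSet_Ioi]
        filter_upwards [ae_mem_of_mem_processes hp] with t ht htT
        have hst : s ≤ t := hT.trans (le_of_lt htT)
        exact hP.abs_discountedCost_le (hs.trans hst) _ (ht hst) (hR t hst)
    _ = _ := by
        rw [integral_const_mul, integral_exp_mul_Ioi (by linarith)]
        field_simp

lemma cost_eq_add (hp : p ∈ P.processes s z) {T : ℝ} (hT : s ≤ T) :
    P.cost s p = (∫ t in s..T, P.runningCost p t) + ∫ t in Ioi T, P.runningCost p t := by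
  rw [cost, intervalIntegral.integral_of_le hT, ← setIntegral_union _ measurableSet_Ioi
    (hp.2.2.mono_set Ioc_subset_Ioi_self) (hp.2.2.mono_set (Ioi_subset_Ioi hT)),
    Ioc_union_Ioi_eq_Ioi hT]
  exact Set.disjoint_left.2 fun x hx hx' => not_lt_of_ge hx.2 hx'

lemma IsRegular.bddBelow_cost (hP : P.IsRegular K₁ K₂) (hs : 0 ≤ s)
    (hR : ∀ p ∈ P.processes s z, ∀ t, s ≤ t → ‖p.1 t‖ ≤ R) :
    BddBelow (P.cost s '' P.processes s z) := by
  refine ⟨-(K₂ * (1 + R) / P.δ * Real.exp (-P.δ * s)), ?_⟩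
  rintro _ ⟨p, hp, rfl⟩
  exact (abs_le.1 (hP.abs_setIntegral_runningCost_le hs hp (hR p hp) le_rfl)).1

lemma sub_eq_integral_of_mem_processes (hp : p ∈ P.processes s z) {t t' : ℝ} (ht : s ≤ t)
    (ht' : s ≤ t') : p.1 t' - p.1 t = ∫ r in t..t', P.f r (p.1 r) (p.2 r) := by
  rw [(hp.2.1 t ht).2, (hp.2.1 t' ht').2, add_sub_add_left_eq_sub,
    intervalIntegral.integral_interval_sub_left (hp.2.1 t' ht').1 (hp.2.1 t ht).1]

lemma IsRegular.norm_sub_le_of_mem_processes (hP : P.IsRegular K₁ K₂) (hs : 0 ≤ s)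
    (hp : p ∈ P.processes s z) (hR : ∀ t, s ≤ t → ‖p.1 t‖ ≤ R) {t t' : ℝ} (ht : s ≤ t)
    (ht' : s ≤ t') : ‖p.1 t' - p.1 t‖ ≤ K₂ * (1 + R) * |t' - t| := by
  rw [sub_eq_integral_of_mem_processes hp ht ht']
  refine intervalIntegral.norm_integral_le_of_norm_le_const_ae ?_
  filter_upwards [ae_mem_of_mem_processes hp] with r hr hrt
  have hsr : s ≤ r := (le_min ht ht').trans hrt.1.le
  have := hP.growth_pos
  exact (hP.norm_f_le r (hs.trans hsr) _ _ (hr hsr)).trans (by gcongr; exact hR r hsr)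

end Bounds

/-! ### Concatenation of arcs and processes. -/

section Concatenation

/-- An admissible arc `(x, u)` on the bounded interval `[s, t]` issuing from `(s, z)`. -/
structure IsArc (P : ControlProblem n m) (s t : ℝ) (z : EuclideanSpace ℝ (Fin n))
    (p : (ℝ → EuclideanSpace ℝ (Fin n)) × (ℝ → EuclideanSpace ℝ (Fin m))) : Prop where
  integrableOn_control : IntegrableOn p.2 (Icc s t)
  control_mem : ∀ᵐ r, r ∈ Icc s t → p.2 r ∈ P.Ω
  trajectory : ∀ r ∈ Icc s t, IntervalIntegrable (fun r => P.f r (p.1 r) (p.2 r)) volume s r ∧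
    p.1 r = z + ∫ r in s..r, P.f r (p.1 r) (p.2 r)
  integrableOn_cost : IntegrableOn (P.runningCost p) (Ioc s t)

/-- The concatenation of `p` up to time `t` and `q` after time `t`. -/
noncomputable def concat (t : ℝ)
    (p q : (ℝ → EuclideanSpace ℝ (Fin n)) × (ℝ → EuclideanSpace ℝ (Fin m))) :
    (ℝ → EuclideanSpace ℝ (Fin n)) × (ℝ → EuclideanSpace ℝ (Fin m)) :=
  (fun r => if r ≤ t then p.1 r else q.1 r, fun r => if r ≤ t then p.2 r else q.2 r)

variable {P : ControlProblem n m} {s t : ℝ} {z : EuclideanSpace ℝ (Fin n)}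
  {p q : (ℝ → EuclideanSpace ℝ (Fin n)) × (ℝ → EuclideanSpace ℝ (Fin m))}

lemma concat_fst_of_le {r : ℝ} (h : r ≤ t) : (concat t p q).1 r = p.1 r :=
  if_pos h

lemma concat_snd_of_le {r : ℝ} (h : r ≤ t) : (concat t p q).2 r = p.2 r :=
  if_pos h

lemma concat_fst_of_lt {r : ℝ} (h : t < r) : (concat t p q).1 r = q.1 r :=
  if_neg (not_le_of_gt h)

lemma concat_snd_of_lt {r : ℝ} (h : t < r) : (concat t p q).2 r = q.2 r :=
  if_neg (not_le_of_gt h)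

lemma runningCost_concat_of_le {r : ℝ} (h : r ≤ t) :
    P.runningCost (concat t p q) r = P.runningCost p r := by
  rw [runningCost, concat_fst_of_le h, concat_snd_of_le h, runningCost]

lemma runningCost_concat_of_lt {r : ℝ} (h : t < r) :
    P.runningCost (concat t p q) r = P.runningCost q r := by
  rw [runningCost, concat_fst_of_lt h, concat_snd_of_lt h, runningCost]

lemma isArc_of_mem_processes (hp : p ∈ P.processes s z) (t : ℝ) : P.IsArc s t z p where
  integrableOn_control := hp.1.1.integrableOn_compact_subset Icc_subset_Ici_self isCompact_Icc
  control_mem := (ae_mem_of_mem_processes hp).mono fun _ h hr => h hr.1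
  trajectory r hr := hp.2.1 r hr.1
  integrableOn_cost := hp.2.2.mono_set Ioc_subset_Ioi_self

lemma IsArc.concat_mem_processes (hst : s ≤ t) (hp : P.IsArc s t z p)
    (hq : q ∈ P.processes t (p.1 t)) : concat t p q ∈ P.processes s z := by
  have htq : q.1 t = p.1 t := by simpa using (hq.2.1 t le_rfl).2
  refine ⟨⟨?_, ?_⟩, ?_, ?_⟩
  · rw [locallyIntegrableOn_iff isClosed_Ici.isLocallyClosed]
    intro k hk hkc
    have h1 : IntegrableOn (concat t p q).2 (Icc s t) :=
      hp.integrableOn_control.congr_fun (fun r hr => (concat_snd_of_le hr.2).symm)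
        measurableSet_Icc
    have h2 : IntegrableOn (concat t p q).2 (k ∩ Ioi t) := by
      refine IntegrableOn.congr_fun (f := q.2) ?_ (fun r hr => (concat_snd_of_lt hr.2).symm)
        (hkc.measurableSet.inter measurableSet_Ioi)
      exact (hq.1.1.integrableOn_compact_subset inter_subset_right
        (hkc.inter_right isClosed_Ici)).mono_set (inter_subset_inter_right k Ioi_subset_Ici_self)
    refine (h1.union h2).mono_set fun r hr => ?_
    rcases le_or_gt r t with h | h
    exacts [Or.inl ⟨hk hr, h⟩, Or.inr ⟨hr, h⟩]
  · rw [ae_restrict_iff' measurableSet_Ici]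
    filter_upwards [hp.control_mem, ae_mem_of_mem_processes hq] with r h1 h2 hr
    rcases le_or_gt r t with h | h
    · rw [concat_snd_of_le h]; exact h1 ⟨hr, h⟩
    · rw [concat_snd_of_lt h]; exact h2 h.le
  -- The switching time belongs to the first piece; half-open intervals make the integrands agree
  -- exactly on each side.
  · have hle : ∀ r ∈ Icc s t, EqOn (fun r => P.f r (p.1 r) (p.2 r))
        (fun r => P.f r ((concat t p q).1 r) ((concat t p q).2 r)) (uIoc s r) := by
      intro r hr r' hr'
      rw [uIoc_of_le hr.1] at hr'
      have : r' ≤ t := hr'.2.trans hr.2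
      dsimp only
      rw [concat_fst_of_le this, concat_snd_of_le this]
    have hlt : ∀ r, t ≤ r → EqOn (fun r => P.f r (q.1 r) (q.2 r))
        (fun r => P.f r ((concat t p q).1 r) ((concat t p q).2 r)) (uIoc t r) := by
      intro r hr r' hr'
      rw [uIoc_of_le hr] at hr'
      dsimp only
      rw [concat_fst_of_lt hr'.1, concat_snd_of_lt hr'.1]
    have hA : ∀ r ∈ Icc s t, IntervalIntegrable
        (fun r => P.f r ((concat t p q).1 r) ((concat t p q).2 r)) volume s r ∧
        p.1 r = z + ∫ r in s..r, P.f r ((concat t p q).1 r) ((concat t p q).2 r) := by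
      intro r hr
      obtain ⟨h1, h2⟩ := hp.trajectory r hr
      refine ⟨h1.congr (hle r hr), h2.trans ?_⟩
      rw [intervalIntegral.integral_congr_ae (Eventually.of_forall fun x hx => hle r hr hx)]
    intro r hr
    rcases le_or_gt r t with h | h
    · rw [concat_fst_of_le h]
      exact hA r ⟨hr, h⟩
    · obtain ⟨h1, h2⟩ := hq.2.1 r h.le
      obtain ⟨h3, h4⟩ := hA t ⟨hst, le_rfl⟩
      have h5 := h1.congr (hlt r h.le)
      refine ⟨h3.trans h5, ?_⟩
      rw [concat_fst_of_lt h, h2, h4, ← intervalIntegral.integral_add_adjacent_intervals h3 h5,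
        add_assoc,
        intervalIntegral.integral_congr_ae (Eventually.of_forall fun x hx => hlt r h.le hx)]
  · rw [← Ioc_union_Ioi_eq_Ioi hst]
    exact (hp.integrableOn_cost.congr_fun (fun r hr => (runningCost_concat_of_le hr.2).symm)
      measurableSet_Ioc).union
      (hq.2.2.congr_fun (fun r hr => (runningCost_concat_of_lt hr).symm) measurableSet_Ioi)

lemma integral_runningCost_concat_of_le (hst : s ≤ t) :
    ∫ r in s..t, P.runningCost (concat t p q) r = ∫ r in s..t, P.runningCost p r := by
  refine intervalIntegral.integral_congr_ae (Eventually.of_forall fun r hr => ?_)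
  rw [uIoc_of_le hst] at hr
  exact runningCost_concat_of_le hr.2

lemma integral_runningCost_concat_of_ge {t' : ℝ} (h : t ≤ t') :
    ∫ r in t..t', P.runningCost (concat t p q) r = ∫ r in t..t', P.runningCost q r := by
  refine intervalIntegral.integral_congr_ae (Eventually.of_forall fun r hr => ?_)
  rw [uIoc_of_le h] at hr
  exact runningCost_concat_of_lt hr.1

end Concatenation

/-! ### Short arcs with a constant control. -/

section ConstantControl

variable {P : ControlProblem n m} {K₁ K₂ : ℝ}

/-- Picard–Lindelöf on the unit ball around y, where the speed is at most K₂(2 + R). The admissible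
length depends on neither t, y nor u, which later gives a uniform step. -/
lemma IsRegular.exists_isArc_const (hP : P.IsRegular K₁ K₂) {t h R : ℝ} (ht : 0 ≤ t)
    (hh : 0 ≤ h) {y : EuclideanSpace ℝ (Fin n)} (hy : ‖y‖ ≤ R)
    {u : EuclideanSpace ℝ (Fin m)} (hu : u ∈ P.Ω) (hhR : K₂ * (2 + R) * h ≤ 1) :
    ∃ x : ℝ → EuclideanSpace ℝ (Fin n), P.IsArc t (t + h) y (x, fun _ => u) ∧ Continuous x ∧
      ∀ r ∈ Icc t (t + h), ‖x r - y‖ ≤ K₂ * (2 + R) * (r - t) := by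
  have hR : 0 ≤ R := (norm_nonneg y).trans hy
  have hK₁ := hP.lipschitz_pos
  have hK₂ := hP.growth_pos
  have htt : t ∈ Icc t (t + h) := ⟨le_rfl, by linarith⟩
  set B : NNReal := .mk (K₂ * (2 + R)) (by positivity) with hB
  have hBc : (B : ℝ) = K₂ * (2 + R) := rfl
  have hPL : IsPicardLindelof (fun r x => P.f r x u) (⟨t, htt⟩ : Icc t (t + h)) y 1 0 B
      (.mk K₁ hK₁.le) := by
    refine ⟨fun r hr => ?_, fun x _ => ?_, fun r hr x hx => ?_, ?_⟩
    · refine LipschitzOnWith.of_dist_le_mul fun x _ x' _ => ?_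
      rw [dist_eq_norm, dist_eq_norm]
      exact hP.lipschitz r (ht.trans hr.1) u hu x x'
    · refine hP.continuousOn_f.comp (f := fun r => (r, x, u)) (by fun_prop) fun r hr => ?_
      exact ⟨ht.trans hr.1, trivial⟩
    · refine (hP.norm_f_le r (ht.trans hr.1) x u hu).trans ?_
      rw [hBc]
      have : ‖x‖ ≤ ‖x - y‖ + ‖y‖ := by simpa using norm_add_le (x - y) y
      rw [mem_closedBall_iff_norm] at hx
      have hx' : ‖x - y‖ ≤ 1 := by simpa using hx
      exact mul_le_mul_of_nonneg_left (by linarith) hK₂.le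
    · simpa [hBc, hh] using hhR
  obtain ⟨α, hα⟩ := ODE.FunSpace.exists_isFixedPt_next hPL (x := y) (by simp)
  replace hα := (ODE.FunSpace.isFixedPt_next_iff hPL (by simp)).1 hα
  have hx : ∀ r ∈ Icc t (t + h), α.compProj r = y + ∫ r in t..r, P.f r (α.compProj r) u := by
    intro r hr
    rw [α.compProj_of_mem hr, hα]
    rfl
  have hxt : α.compProj t = y := by simpa using hx t htt
  have hf : ContinuousOn (fun r => P.f r (α.compProj r) u) (Icc t (t + h)) :=
    α.continuousOn_comp_compProj hPL
  have hLc : ContinuousOn (fun r => P.discountedCost r (α.compProj r) u) (Icc t (t + h)) := by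
    refine hP.continuousOn_discountedCost.comp (f := fun r => (r, α.compProj r, u))
      (by fun_prop) fun r hr => ?_
    exact ⟨ht.trans hr.1, trivial⟩
  refine ⟨α.compProj, ⟨?_, ?_, ?_, ?_⟩, α.continuous_compProj, ?_⟩
  · exact integrableOn_const (by simp)
  · exact Eventually.of_forall fun _ _ => hu
  · intro r hr
    refine ⟨ContinuousOn.intervalIntegrable (hf.mono ?_), hx r hr⟩
    rw [uIcc_of_le hr.1]
    exact Icc_subset_Icc_right hr.2
  · exact (hLc.integrableOn_Icc).mono_set Ioc_subset_Icc_self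
  · intro r hr
    have h1 := α.lipschitzWith.dist_le_mul ⟨r, hr⟩ ⟨t, htt⟩
    rw [← α.compProj_of_mem hr, ← α.compProj_of_mem htt, hxt, dist_eq_norm, Subtype.dist_eq,
      Real.dist_eq, abs_of_nonneg (by simpa using hr.1)] at h1
    exact h1

end ConstantControl

end ControlProblem

/-! ### Choice of a finite horizon. -/

section Horizon

variable {n : ℕ}

/-- The margin T - 1 leaves room for maximisers of the penalized function centred at time T, whose
time may be slightly earlier. -/
lemma DecaysAtInfinity.exists_horizon {Φ : ℝ → EuclideanSpace ℝ (Fin n) → ℝ}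
    (hΦ : DecaysAtInfinity Φ) (s R A : ℝ) {δ κ : ℝ} (hδ : 0 < δ) (hκ : 0 < κ) :
    ∃ T, s ≤ T ∧ A * Real.exp (-δ * T) ≤ κ ∧
      ∀ τ, T - 1 ≤ τ → ∀ y : EuclideanSpace ℝ (Fin n), ‖y‖ ≤ R → |Φ τ y| ≤ κ := by
  have h1 := (Metric.tendstoUniformlyOn_iff.1 (hΦ _ (isCompact_closedBall 0 R)) κ hκ)
  obtain ⟨T₁, hT₁⟩ := eventually_atTop.1 h1
  have h2 : Tendsto (fun T : ℝ => A * Real.exp (-δ * T)) atTop (𝓝 (A * 0)) := by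
    refine (Real.tendsto_exp_atBot.comp ?_).const_mul A
    exact tendsto_id.const_mul_atTop_of_neg (by linarith)
  rw [mul_zero] at h2
  obtain ⟨T₂, hT₂⟩ := eventually_atTop.1 (h2.eventually (ge_mem_nhds hκ))
  refine ⟨max s (max (T₁ + 1) T₂), le_max_left _ _,
    hT₂ _ ((le_max_right _ _).trans (le_max_right _ _)), fun τ hτ y hy => ?_⟩
  have h3 : T₁ + 1 ≤ max s (max (T₁ + 1) T₂) := (le_max_left _ _).trans (le_max_right _ _)
  have := hT₁ τ (by linarith) y (by simpa using hy)
  simpa [dist_zero_left] using this.le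

end Horizon

/-! ### Lipschitz regularity along a curve. -/

section SupConvolution

variable {E : Type*} [NormedAddCommGroup E] [ProperSpace E]

/-- The maximiser for t is a competitor for t', so only the two penalties differ, and these are
quadratics on a bounded set. No regularity of Ψ beyond continuity enters. -/
lemma exists_lipschitzOnWith_supConv {Ψ : ℝ → E → ℝ}
    (hΨ : ContinuousOn (fun q : ℝ × E => Ψ q.1 q.2) (Ici 0 ×ˢ univ)) {s T R b c K : ℝ}
    (hs : 0 ≤ s) (hT : 0 ≤ T) (hR : 0 ≤ R) (hb : 0 ≤ b) (hc : 0 ≤ c) (hK : 0 ≤ K) {x : ℝ → E}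
    (hxR : ∀ t ∈ Icc s T, ‖x t‖ ≤ R)
    (hx : ∀ t ∈ Icc s T, ∀ t' ∈ Icc s T, ‖x t' - x t‖ ≤ K * |t' - t|) :
    ∃ k, LipschitzOnWith k (fun t => supConv Ψ T R b c t (x t)) (Icc s T) := by
  refine ⟨.mk (c * T + b * (2 * R) * K) (by positivity), LipschitzOnWith.of_le_add_mul _ ?_⟩
  intro t ht t' ht'
  obtain ⟨q, hq, hqe, -⟩ := exists_supConv_eq hΨ hT hR b c t (x t)
  have h1 := penalized_le_supConv hΨ b c t' (x t') hq
  rw [hqe]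
  refine le_trans ?_ (add_le_add_left h1 _)
  obtain ⟨⟨hq0, hqT⟩, hqR⟩ := mem_timeCylinder_iff.1 hq
  have e1 : (q.1 - t') ^ 2 - (q.1 - t) ^ 2 ≤ 2 * T * |t - t'| := by
    have h2 : |q.1 - t' + (q.1 - t)| ≤ 2 * T := by
      rw [abs_le]; constructor <;> linarith [ht.1, ht.2, ht'.1, ht'.2]
    calc (q.1 - t') ^ 2 - (q.1 - t) ^ 2 = (q.1 - t' + (q.1 - t)) * (t - t') := by ring
      _ ≤ |q.1 - t' + (q.1 - t)| * |t - t'| := by rw [← abs_mul]; exact le_abs_self _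
      _ ≤ _ := by gcongr
  have e2 : ‖q.2 - x t'‖ ^ 2 - ‖q.2 - x t‖ ^ 2 ≤ 2 * (2 * R) * (K * |t - t'|) := by
    have h2 : ‖q.2 - x t'‖ ≤ 2 * R := by
      linarith [norm_sub_le q.2 (x t'), hxR t' ht']
    have h3 : ‖q.2 - x t‖ ≤ 2 * R := by
      linarith [norm_sub_le q.2 (x t), hxR t ht]
    have h4 : ‖q.2 - x t'‖ - ‖q.2 - x t‖ ≤ K * |t - t'| := by
      refine (norm_sub_norm_le _ _).trans ?_
      rw [sub_sub_sub_cancel_left]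
      exact hx t' ht' t ht
    have h5 : 0 ≤ K * |t - t'| := by positivity
    calc ‖q.2 - x t'‖ ^ 2 - ‖q.2 - x t‖ ^ 2
        = (‖q.2 - x t'‖ + ‖q.2 - x t‖) * (‖q.2 - x t'‖ - ‖q.2 - x t‖) := by ring
      _ ≤ (‖q.2 - x t'‖ + ‖q.2 - x t‖) * (K * |t - t'|) := by gcongr
      _ ≤ _ := by gcongr; linarith
  have e3 := mul_le_mul_of_nonneg_left e1 hc
  have e4 := mul_le_mul_of_nonneg_left e2 hb
  rw [Real.dist_eq]
  simp only [penalized]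
  change _ ≤ _ + (c * T + b * (2 * R) * K) * |t - t'|
  linarith

end SupConvolution

/-! ### Penalties for the control data, and the sub-solution inequality. -/

namespace ControlProblem

variable {n m : ℕ} {P : ControlProblem n m} {K₁ K₂ : ℝ}

/-- The penalty weights `b`, `c` are strong enough for `Ψ` on `[0, T] × B(0, R)`: maximisers of the
penalized function are `θ`-close to the centre, and so are the values of the dynamics (tested
against the penalty gradient) and of the discounted cost. -/
def IsPenalty (P : ControlProblem n m) (Ψ : ℝ → EuclideanSpace ℝ (Fin n) → ℝ)
    (T R θ b c : ℝ) : Prop :=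
  ∀ t ∈ Icc 0 T, ∀ y : EuclideanSpace ℝ (Fin n), ‖y‖ ≤ R →
    ∀ q ∈ timeCylinder (EuclideanSpace ℝ (Fin n)) (T + 1) (R + 1),
    (∀ q' ∈ timeCylinder (EuclideanSpace ℝ (Fin n)) (T + 1) (R + 1),
      penalized Ψ b c t y q' ≤ penalized Ψ b c t y q) →
    |q.1 - t| ≤ θ ∧ ‖q.2 - y‖ ≤ θ ∧
    ∀ u ∈ P.Ω, |b * inner ℝ (q.2 - y) (P.f q.1 q.2 u - P.f t y u)| +
      |P.discountedCost q.1 q.2 u - P.discountedCost t y u| ≤ θ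

lemma IsRegular.exists_isPenalty (hP : P.IsRegular K₁ K₂)
    {Ψ : ℝ → EuclideanSpace ℝ (Fin n) → ℝ}
    (hΨ : ContinuousOn (fun q : ℝ × EuclideanSpace ℝ (Fin n) => Ψ q.1 q.2) (Ici 0 ×ˢ univ))
    (T R : ℝ) {θ : ℝ} (hθ : 0 < θ) :
    ∃ b c : ℝ, 0 < b ∧ 0 < c ∧ P.IsPenalty Ψ T R θ b c :=
  exists_penalty hP.isCompact hΨ hP.continuousOn_f hP.continuousOn_discountedCost
    hP.lipschitz_pos hP.lipschitz T R hθ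

lemma IsRegular.hamiltonian_le (hP : P.IsRegular K₁ K₂) {t : ℝ} (ht : 0 ≤ t)
    (x lam : EuclideanSpace ℝ (Fin n)) {u : EuclideanSpace ℝ (Fin m)} (hu : u ∈ P.Ω) :
    P.hamiltonian t x lam ≤ inner ℝ lam (P.f t x u) + P.discountedCost t x u := by
  refine csInf_le ?_ ⟨u, hu, rfl⟩
  refine (hP.isCompact.image_of_continuousOn ?_).bddBelow
  have h : ContinuousOn (fun u : EuclideanSpace ℝ (Fin m) => (t, x, u)) P.Ω := by fun_prop
  have hm : MapsTo (fun u : EuclideanSpace ℝ (Fin m) => (t, x, u)) P.Ω (Ici 0 ×ˢ univ) :=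
    fun _ _ => ⟨ht, trivial⟩
  exact (continuousOn_const.inner (hP.continuousOn_f.comp h hm)).add
    (hP.continuousOn_discountedCost.comp h hm)

section Subsolution

variable {Φ : ℝ → EuclideanSpace ℝ (Fin n) → ℝ}

/-- Let (τ, y) be the maximiser. Sliding the centre along the trajectory in step with time gives a
function touching Φ from above at (τ, y), whose gradient contains d. The Hamilton-Jacobi inequality
there, tested with the control u, is carried back to (t₀, x(t₀)) at cost θ. -/
lemma IsDiniSubsolution.neg_discountedCost_le_deriv (hP : P.IsRegular K₁ K₂)
    (hΦ : P.IsDiniSubsolution Φ) {s T R θ b c : ℝ} (hs : 0 ≤ s) (hR : 0 ≤ R)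
    (hpen : P.IsPenalty Φ T R θ b c) (hθ : θ < 1) {x : ℝ → EuclideanSpace ℝ (Fin n)}
    (hxR : ∀ t ∈ Icc s T, ‖x t‖ ≤ R) {t₀ : ℝ} (ht₀ : t₀ ∈ Ioo s T)
    {u : EuclideanSpace ℝ (Fin m)} (hu : u ∈ P.Ω) (hx : HasDerivAt x (P.f t₀ (x t₀) u) t₀)
    {d : ℝ} (hd : HasDerivAt (fun t => supConv Φ (T + 1) (R + 1) b c t (x t)) d t₀) :
    -P.discountedCost t₀ (x t₀) u - θ ≤ d := by
  have hT : 0 ≤ T := hs.trans (ht₀.1.trans ht₀.2).le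
  have ht₀' : t₀ ∈ Icc s T := Ioo_subset_Icc_self ht₀
  obtain ⟨⟨τ, y⟩, hq, hqe, hmax⟩ := exists_supConv_eq hΦ.continuousOn
    (by linarith : 0 ≤ T + 1) (by linarith : 0 ≤ R + 1) b c t₀ (x t₀)
  obtain ⟨h1, h2, h3⟩ := hpen t₀ ⟨hs.trans ht₀.1.le, ht₀.2.le⟩ (x t₀) (hxR _ ht₀') _ hq hmax
  obtain ⟨⟨hτ0, -⟩, -⟩ := mem_timeCylinder_iff.1 hq
  dsimp only at h1 h2 h3 hτ0
  have hτT : τ < T + 1 := by linarith [(abs_le.1 h1).2, ht₀.2]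
  have hyR : ‖y‖ < R + 1 := by
    have : ‖y‖ ≤ ‖y - x t₀‖ + ‖x t₀‖ := by simpa using norm_add_le (y - x t₀) (x t₀)
    linarith [hxR _ ht₀']
  set M : ℝ → ℝ := fun t => supConv Φ (T + 1) (R + 1) b c t (x t) with hM
  -- The centre time moves with q.1, so the time penalty stays constant and the weight c drops out
  -- of the gradient.
  have hpath : HasFDerivAt (fun q : ℝ × EuclideanSpace ℝ (Fin n) => t₀ + (q.1 - τ))
      (ContinuousLinearMap.fst ℝ ℝ (EuclideanSpace ℝ (Fin n))) (τ, y) :=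
    (hasFDerivAt_fst.sub_const τ).const_add t₀
  have hd' : HasDerivAt M d (t₀ + ((τ, y).1 - τ)) := by simpa using hd
  have hx' : HasDerivAt x (P.f t₀ (x t₀) u) (t₀ + ((τ, y).1 - τ)) := by simpa using hx
  have hF := ((hd'.comp_hasFDerivAt (τ, y) hpath).add_const (c / 2 * (τ - t₀) ^ 2)).add
    ((hasFDerivAt_snd.sub (hx'.hasFDerivAt.comp (τ, y) hpath)).norm_sq.const_mul (b / 2))
  have hmem : (d - inner ℝ (b • (y - x t₀)) (P.f t₀ (x t₀) u), b • (y - x t₀)) ∈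
      diniSupergradient Φ τ y := by
    refine mem_diniSupergradient_of_eventually_le hF ?_ ?_ ?_
    · intro a v
      simp [inner_smul_left, inner_smul_right, inner_sub_right, inner_sub_left, real_inner_comm v]
      ring
    · simp [hM, hqe, penalized]
      ring
    · have hev : ∀ᶠ q : ℝ × EuclideanSpace ℝ (Fin n) in 𝓝 (τ, y),
          t₀ + (q.1 - τ) ∈ Ioo s T ∧ q.1 < T + 1 ∧ ‖q.2‖ < R + 1 := by
        refine (Eventually.and ?_ (Eventually.and ?_ ?_))
        · exact hpath.continuousAt.eventually (isOpen_Ioo.mem_nhds (by simpa using ht₀))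
        · exact continuousAt_fst.eventually (gt_mem_nhds hτT)
        · exact continuousAt_snd.norm.eventually (gt_mem_nhds hyR)
      filter_upwards [nhdsWithin_le_nhds hev, self_mem_nhdsWithin] with q hq1 hq2
      have h4 := penalized_le_supConv hΦ.continuousOn b c (t₀ + (q.1 - τ)) (x (t₀ + (q.1 - τ)))
        (q := q) (mem_timeCylinder_iff.2 ⟨⟨hq2.1, hq1.2.1.le⟩, hq1.2.2.le⟩)
      simp only [penalized] at h4
      have h5 : q.1 - (t₀ + (q.1 - τ)) = τ - t₀ := by ring
      rw [h5] at h4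
      simp only [hM, Function.comp_apply, Pi.add_apply, Pi.sub_apply]
      linarith
  have h4 := hΦ.hjb τ hτ0 y _ hmem
  have h5 := hP.hamiltonian_le hτ0 y (b • (y - x t₀)) hu
  have h6 := h3 u hu
  rw [← real_inner_smul_left, inner_sub_right] at h6
  have h7 := le_abs_self (inner ℝ (b • (y - x t₀)) (P.f τ y u) -
    inner ℝ (b • (y - x t₀)) (P.f t₀ (x t₀) u))
  have h8 := le_abs_self (P.discountedCost τ y u - P.discountedCost t₀ (x t₀) u)
  dsimp only at h4
  linarith

lemma IsDiniSubsolution.le_cost (hP : P.IsRegular K₁ K₂) (hΦ : P.IsDiniSubsolution Φ) {s R : ℝ}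
    (hs : 0 ≤ s) {z : EuclideanSpace ℝ (Fin n)}
    {p : (ℝ → EuclideanSpace ℝ (Fin n)) × (ℝ → EuclideanSpace ℝ (Fin m))}
    (hp : p ∈ P.processes s z) (hR : ∀ t, s ≤ t → ‖p.1 t‖ ≤ R) : Φ s z ≤ P.cost s p := by
  have hz : p.1 s = z := by simpa using (hp.2.1 s le_rfl).2
  have hR0 : 0 ≤ R := (norm_nonneg _).trans (hR s le_rfl)
  have hK₂ := hP.growth_pos
  refine le_of_forall_pos_le_add fun κ hκ => ?_
  obtain ⟨T, hsT, hTe, hTΦ⟩ := hΦ.decay.exists_horizon s (R + 1) (K₂ * (1 + R) / P.δ)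
    hP.discount_pos (by positivity : 0 < κ / 3)
  have hsT' : 0 ≤ T - s := by linarith
  -- The bound 1/2 keeps maximisers inside the enlarged cylinder; the other makes the integrated
  -- error at most κ / 3.
  set θ := min (1 / 2) (κ / (3 * (T - s + 1))) with hθdef
  have hθ : 0 < θ := by positivity
  have hθ1 : θ ≤ 1 / 2 := min_le_left _ _
  have hθκ : θ * (T - s) ≤ κ / 3 := by
    calc θ * (T - s) ≤ κ / (3 * (T - s + 1)) * (T - s + 1) := by
          gcongr
          · exact min_le_right _ _
          · linarith
      _ = κ / 3 := by field_simp
  obtain ⟨b, c, hb, hc, hpen⟩ := hP.exists_isPenalty hΦ.continuousOn T R hθ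
  set M : ℝ → ℝ := fun t => supConv Φ (T + 1) (R + 1) b c t (p.1 t) with hM
  have hxR : ∀ t ∈ Icc s T, ‖p.1 t‖ ≤ R := fun t ht => hR t ht.1
  obtain ⟨k, hk⟩ := exists_lipschitzOnWith_supConv hΦ.continuousOn (s := s) (T := T + 1)
    (R := R + 1) (K := K₂ * (1 + R)) (x := p.1) hs (by linarith) (by linarith) hb.le hc.le
    (by positivity) (fun t ht => (hR t ht.1).trans (by linarith))
    (fun t ht t' ht' => hP.norm_sub_le_of_mem_processes hs hp hR ht.1 ht'.1)
  have hac : AbsolutelyContinuousOnInterval M s T := by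
    refine LipschitzOnWith.absolutelyContinuousOnInterval (hk.mono ?_)
    rw [uIcc_of_le hsT]
    exact Icc_subset_Icc_right (by linarith)
  have hLi : IntervalIntegrable (P.runningCost p) volume s T :=
    (intervalIntegrable_iff_integrableOn_Ioc_of_le hsT).2 (hp.2.2.mono_set Ioc_subset_Ioi_self)
  have hLn : IntervalIntegrable (fun t => -P.runningCost p t) volume s T := hLi.neg
  have hmono : ∫ t in s..T, (-P.runningCost p t - θ) ≤ ∫ t in s..T, deriv M t := by
    refine intervalIntegral.integral_mono_ae_restrict hsT
      (hLn.sub intervalIntegrable_const) hac.intervalIntegrable_deriv ?_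
    -- Endpoints are discarded because the integral formula for the trajectory holds only from s on,
    -- while a two-sided derivative is needed.
    rw [← restrict_Ioo_eq_restrict_Icc, EventuallyLE, ae_restrict_iff' measurableSet_Ioo]
    filter_upwards [hac.ae_differentiableAt, (hp.2.1 T hsT).1.ae_hasDerivAt_integral,
      ae_mem_of_mem_processes hp] with t h1 h2 h3 ht
    have ht' : t ∈ uIcc s T := by rw [uIcc_of_le hsT]; exact Ioo_subset_Icc_self ht
    refine hΦ.neg_discountedCost_le_deriv hP hs hR0 hpen (by linarith) hxR ht (h3 ht.1.le) ?_
      (h1 ht').hasDerivAt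
    refine ((h2 ht' s left_mem_uIcc).const_add z).congr_of_eventuallyEq ?_
    filter_upwards [Ioi_mem_nhds ht.1] with r hr
    exact (hp.2.1 r (le_of_lt hr)).2
  rw [hac.integral_deriv_eq_sub, intervalIntegral.integral_sub hLn intervalIntegrable_const,
    intervalIntegral.integral_neg, intervalIntegral.integral_const, smul_eq_mul] at hmono
  have hMs : Φ s z ≤ M s := by
    rw [← hz]
    exact le_supConv hΦ.continuousOn b c (mem_timeCylinder_iff.2
      ⟨⟨hs, by dsimp; linarith⟩, (hR s le_rfl).trans (by linarith)⟩)
  have hMT : M T ≤ κ / 3 := by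
    obtain ⟨q, hq, hqe, hmax⟩ := exists_supConv_eq hΦ.continuousOn
      (by linarith : 0 ≤ T + 1) (by linarith : 0 ≤ R + 1) b c T (p.1 T)
    obtain ⟨h1, -, -⟩ := hpen T ⟨hs.trans hsT, le_rfl⟩ (p.1 T) (hR T hsT) q hq hmax
    have h2 := (abs_le.1 (hTΦ q.1 (by linarith [(abs_le.1 h1).1]) q.2
      (mem_timeCylinder_iff.1 hq).2)).2
    have h3 : 0 ≤ c / 2 * (q.1 - T) ^ 2 := by positivity
    have h4 : 0 ≤ b / 2 * ‖q.2 - p.1 T‖ ^ 2 := by positivity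
    simp only [hM, hqe, penalized]
    linarith
  have htail := (abs_le.1 (hP.abs_setIntegral_runningCost_le hs hp hR hsT)).1
  rw [cost_eq_add hp hsT]
  linarith

end Subsolution

end ControlProblem

/-! ### Super-solutions: near-optimal processes built step by step. -/

namespace ControlProblem

variable {n m : ℕ} {P : ControlProblem n m} {K₁ K₂ : ℝ}

section Supersolution

variable {Φ : ℝ → EuclideanSpace ℝ (Fin n) → ℝ}

lemma IsDiniSupersolution.continuousOn_neg (hΦ : P.IsDiniSupersolution Φ) :
    ContinuousOn (fun q : ℝ × EuclideanSpace ℝ (Fin n) => (fun t x => -Φ t x) q.1 q.2)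
      (Ici 0 ×ˢ univ) :=
  hΦ.continuousOn.neg

/-- At a maximiser of the penalized function of `-Φ`, the penalty gradient is a Dini sub-gradient
of `Φ`, so some control makes the extended velocity point downhill. -/
lemma IsDiniSupersolution.exists_control (hΦ : P.IsDiniSupersolution Φ)
    (hΩ : P.Ω.Nonempty) {T R b c t : ℝ} {y : EuclideanSpace ℝ (Fin n)}
    {q : ℝ × EuclideanSpace ℝ (Fin n)} (hq0 : 0 ≤ q.1) (hqT : q.1 < T) (hqR : ‖q.2‖ < R)
    (hmax : ∀ q' ∈ timeCylinder (EuclideanSpace ℝ (Fin n)) T R,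
      penalized (fun t x => -Φ t x) b c t y q' ≤ penalized (fun t x => -Φ t x) b c t y q)
    {θ : ℝ} (hθ : 0 < θ) :
    ∃ u ∈ P.Ω, -(b * inner ℝ (q.2 - y) (P.f q.1 q.2 u)) + P.discountedCost q.1 q.2 u ≤
      c * (q.1 - t) + θ := by
  obtain ⟨τ, w⟩ := q
  dsimp only at hq0 hqT hqR ⊢
  -- The test function is minus the maximum minus the penalty; maximality says that it lies below Φ.
  have hF := (((((hasFDerivAt_fst (𝕜 := ℝ) (E := ℝ) (F := EuclideanSpace ℝ (Fin n))
    (p := (τ, w))).sub_const t).pow 2).const_mul (c / 2)).add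
    (((hasFDerivAt_snd (𝕜 := ℝ) (E := ℝ) (F := EuclideanSpace ℝ (Fin n))
    (p := (τ, w))).sub_const y).norm_sq.const_mul (b / 2))).const_sub
    (-penalized (fun t x => -Φ t x) b c t y (τ, w))
  have hmem : (-(c * (τ - t)), -(b • (w - y))) ∈ diniSubgradient Φ τ w := by
    refine mem_diniSubgradient_of_eventually_le hF ?_ ?_ ?_
    · intro a v
      simp [inner_smul_right, inner_sub_right, real_inner_comm v]
      ring
    · simp [penalized]
      ring
    · have hev : ∀ᶠ q : ℝ × EuclideanSpace ℝ (Fin n) in 𝓝 (τ, w), q.1 < T ∧ ‖q.2‖ < R :=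
        (continuousAt_fst.eventually (gt_mem_nhds hqT)).and
          (continuousAt_snd.norm.eventually (gt_mem_nhds hqR))
      filter_upwards [nhdsWithin_le_nhds hev, self_mem_nhdsWithin] with q hq1 hq2
      have h4 := hmax q (mem_timeCylinder_iff.2 ⟨⟨hq2.1, hq1.1.le⟩, hq1.2.le⟩)
      simp only [penalized] at h4
      simp only [penalized, Pi.add_apply]
      linarith
  have h1 := hΦ.hjb τ hq0 w _ hmem
  dsimp only at h1
  obtain ⟨_, ⟨u, hu, rfl⟩, h2⟩ := exists_lt_of_csInf_lt (hΩ.image _)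
    (show P.hamiltonian τ w (-(b • (w - y))) < c * (τ - t) + θ by linarith)
  refine ⟨u, hu, ?_⟩
  dsimp only at h2
  rw [inner_neg_left, real_inner_smul_left] at h2
  exact h2.le

/-- The maximiser q for (t, y) remains a competitor at the end of the arc. Expanding its penalty,
the first-order part of the increment matches the inequality satisfied by the chosen control. Four
errors of size θ come from that control, the penalty, and the continuity of f and of the cost; the
fifth absorbs the second-order terms. -/
lemma IsDiniSupersolution.exists_isArc_step (hP : P.IsRegular K₁ K₂)
    (hΦ : P.IsDiniSupersolution Φ) (hΩ : P.Ω.Nonempty) {T R θ b c : ℝ} (hT : 0 ≤ T) (hR : 0 ≤ R)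
    (hθ : 0 < θ) (hθ1 : θ < 1) (hb : 0 < b) (hc : 0 < c)
    (hpen : P.IsPenalty (fun t x => -Φ t x) T R θ b c) :
    ∃ h₀ > 0, ∀ t ∈ Icc 0 T, ∀ y : EuclideanSpace ℝ (Fin n), ‖y‖ ≤ R → ∀ h, 0 ≤ h → h ≤ h₀ →
      ∃ p, P.IsArc t (t + h) y p ∧ ∫ r in t..t + h, P.runningCost p r ≤
        supConv (fun t x => -Φ t x) (T + 1) (R + 1) b c (t + h) (p.1 (t + h)) -
        supConv (fun t x => -Φ t x) (T + 1) (R + 1) b c t y + 5 * θ * h := by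
  have hK₂ := hP.growth_pos
  set B := K₂ * (2 + R) with hB
  have hB0 : 0 < B := by positivity
  set D : Set (ℝ × EuclideanSpace ℝ (Fin n) × EuclideanSpace ℝ (Fin m)) :=
    Icc 0 (T + 1) ×ˢ (Metric.closedBall 0 (R + 1) ×ˢ P.Ω) with hD
  have hDc : IsCompact D := isCompact_Icc.prod ((isCompact_closedBall _ _).prod hP.isCompact)
  have hDs : D ⊆ Ici 0 ×ˢ univ := prod_mono Icc_subset_Ici_self (subset_univ _)
  have hFu := hDc.uniformContinuousOn_of_continuous (hP.continuousOn_f.mono hDs)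
  have hLu := hDc.uniformContinuousOn_of_continuous (hP.continuousOn_discountedCost.mono hDs)
  rw [Metric.uniformContinuousOn_iff] at hFu hLu
  -- The penalty gradient has norm at most bθ, so tolerance 1 / b yields an error θ.
  obtain ⟨ρ₁, hρ₁, hF⟩ := hFu (1 / b) (by positivity)
  obtain ⟨ρ₂, hρ₂, hL⟩ := hLu θ hθ
  -- The four bounds keep time below T + 1, keep the arc within distance 1 of y, stay within the
  -- continuity moduli (the factor 2 gives strictness), and make (c + bB²)h² / 2 ≤ θh.
  refine ⟨min (min 1 (1 / B)) (min (min ρ₁ ρ₂ / (2 * (1 + B))) (2 * θ / (c + b * B ^ 2))),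
    by positivity, ?_⟩
  intro t ht y hy h hh hh₀
  have hh1 : h ≤ 1 := hh₀.trans ((min_le_left _ _).trans (min_le_left _ _))
  have hhB : B * h ≤ 1 := by
    have : h ≤ 1 / B := hh₀.trans ((min_le_left _ _).trans (min_le_right _ _))
    rw [le_div_iff₀ hB0] at this
    linarith
  have hhρ : h * (2 * (1 + B)) ≤ min ρ₁ ρ₂ := by
    have : h ≤ min ρ₁ ρ₂ / (2 * (1 + B)) :=
      hh₀.trans ((min_le_right _ _).trans (min_le_left _ _))
    rwa [le_div_iff₀ (by positivity)] at this
  have hhθ : h * (c + b * B ^ 2) ≤ 2 * θ := by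
    have : h ≤ 2 * θ / (c + b * B ^ 2) :=
      hh₀.trans ((min_le_right _ _).trans (min_le_right _ _))
    rwa [le_div_iff₀ (by positivity)] at this
  obtain ⟨q, hq, hqe, hmax⟩ := exists_supConv_eq (Ψ := fun t x => -Φ t x) hΦ.continuousOn_neg
    (by linarith : 0 ≤ T + 1) (by linarith : 0 ≤ R + 1) b c t y
  obtain ⟨h1, h2, h3⟩ := hpen t ht y hy q hq hmax
  obtain ⟨⟨hq0, -⟩, -⟩ := mem_timeCylinder_iff.1 hq
  have hqR : ‖q.2‖ < R + 1 := by
    have : ‖q.2‖ ≤ ‖q.2 - y‖ + ‖y‖ := by simpa using norm_add_le (q.2 - y) y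
    linarith
  obtain ⟨u, hu, hu'⟩ := hΦ.exists_control hΩ hq0 (by linarith [(abs_le.1 h1).2, ht.2]) hqR hmax hθ
  obtain ⟨x, hx, hxc, hxy⟩ := hP.exists_isArc_const (t := t) (h := h) ht.1 hh hy hu hhB
  refine ⟨(x, fun _ => u), hx, ?_⟩
  have htt : t ≤ t + h := by linarith
  have hxt := hx.trajectory (t + h) ⟨htt, le_rfl⟩
  dsimp only at hxt
  have hLi : IntervalIntegrable (P.runningCost (x, fun _ => u)) volume t (t + h) :=
    (intervalIntegrable_iff_integrableOn_Ioc_of_le htt).2 hx.integrableOn_cost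
  set ξ := b • (q.2 - y) with hξ
  have hξn : ‖ξ‖ ≤ b * θ := by
    rw [hξ, norm_smul, Real.norm_of_nonneg hb.le]
    gcongr
  set Δ := x (t + h) - y with hΔ
  have hΔn : ‖Δ‖ ≤ B * h := by simpa using hxy (t + h) ⟨htt, le_rfl⟩
  have hinner : IntervalIntegrable (fun r => inner ℝ ξ (P.f r (x r) u)) volume t (t + h) :=
    ⟨(innerSL ℝ ξ).integrable_comp hxt.1.1, (innerSL ℝ ξ).integrable_comp hxt.1.2⟩
  have hΔint : inner ℝ ξ Δ = ∫ r in t..t + h, inner ℝ ξ (P.f r (x r) u) := by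
    rw [hΔ, hxt.2, add_sub_cancel_left]
    exact ((innerSL ℝ ξ).intervalIntegral_comp_comm hxt.1).symm
  have hpoint : ∀ r ∈ Icc t (t + h), P.runningCost (x, fun _ => u) r -
      inner ℝ ξ (P.f r (x r) u) ≤ c * (q.1 - t) + 4 * θ := by
    intro r hr
    have hr1 : r - t ≤ h := by linarith [hr.2]
    have hxr : ‖x r - y‖ ≤ B * h := (hxy r hr).trans (by gcongr)
    have hρB : 2 * h + 2 * (B * h) ≤ min ρ₁ ρ₂ := by linarith
    have hBh : 0 ≤ B * h := by positivity
    have hmin : 0 < min ρ₁ ρ₂ := by positivity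
    have hdist : dist (r, x r, u) (t, y, u) < min ρ₁ ρ₂ := by
      rw [Prod.dist_eq, Prod.dist_eq, Real.dist_eq, dist_eq_norm, dist_self,
        abs_of_nonneg (by simpa using hr.1)]
      exact max_lt (by dsimp; linarith) (max_lt (by dsimp; linarith) hmin)
    have hxn : ‖x r‖ ≤ R + 1 := by
      have : ‖x r‖ ≤ ‖x r - y‖ + ‖y‖ := by simpa using norm_add_le (x r - y) y
      linarith
    have hrD : (r, x r, u) ∈ D :=
      ⟨⟨ht.1.trans hr.1, by dsimp; linarith [ht.2]⟩, by simpa using hxn, hu⟩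
    have htD : (t, y, u) ∈ D :=
      ⟨⟨ht.1, by dsimp; linarith [ht.2]⟩, by simp; linarith, hu⟩
    have g1 := hF _ hrD _ htD (hdist.trans_le (min_le_left _ _))
    have g2 := hL _ hrD _ htD (hdist.trans_le (min_le_right _ _))
    rw [dist_eq_norm] at g1
    rw [Real.dist_eq] at g2
    dsimp only at g1 g2
    have g3 : |inner ℝ ξ (P.f r (x r) u - P.f t y u)| ≤ θ := by
      calc _ ≤ ‖ξ‖ * ‖P.f r (x r) u - P.f t y u‖ := abs_real_inner_le_norm _ _
        _ ≤ b * θ * (1 / b) := by gcongr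
        _ = θ := by field_simp
    have g4 := h3 u hu
    rw [← real_inner_smul_left, ← hξ] at g4
    rw [← real_inner_smul_left, ← hξ] at hu'
    rw [inner_sub_right] at g3 g4
    rw [runningCost_eq]
    dsimp only
    have a1 := (abs_le.1 g3).1
    have a2 := (abs_lt.1 g2).2
    have a3 := le_abs_self (inner ℝ ξ (P.f q.1 q.2 u) - inner ℝ ξ (P.f t y u))
    have a4 := neg_abs_le (P.discountedCost q.1 q.2 u - P.discountedCost t y u)
    linarith
  have hint := intervalIntegral.integral_mono_on htt (hLi.sub hinner)
    intervalIntegrable_const hpoint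
  rw [intervalIntegral.integral_sub hLi hinner, ← hΔint, intervalIntegral.integral_const,
    add_sub_cancel_left, smul_eq_mul] at hint
  have hW := penalized_le_supConv (Ψ := fun t x => -Φ t x) hΦ.continuousOn_neg b c (t + h) (x (t + h)) hq
  have hxe : q.2 - x (t + h) = q.2 - y - Δ := by rw [hΔ]; abel
  have hsq : ‖q.2 - x (t + h)‖ ^ 2 = ‖q.2 - y‖ ^ 2 - 2 * inner ℝ (q.2 - y) Δ + ‖Δ‖ ^ 2 := by
    rw [hxe, norm_sub_sq_real]
  have hξΔ : inner ℝ ξ Δ = b * inner ℝ (q.2 - y) Δ := real_inner_smul_left _ _ _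
  have hΔ2 : b * ‖Δ‖ ^ 2 ≤ b * (B * h) ^ 2 := by gcongr
  have hh2 := mul_le_mul_of_nonneg_left hhθ hh
  rw [hqe]
  simp only [penalized, hsq] at hW ⊢
  linarith

/-- Induction on the number of steps. Each stage is kept as a full process from (s, z), so the a
priori bound R places its endpoint in the ball where the next step is available. -/
lemma IsDiniSupersolution.exists_process (hP : P.IsRegular K₁ K₂)
    (hΦ : P.IsDiniSupersolution Φ) (hΩ : P.Ω.Nonempty)
    (hne : ∀ τ : ℝ, 0 ≤ τ → ∀ z : EuclideanSpace ℝ (Fin n), (P.processes τ z).Nonempty)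
    {s R T θ b c : ℝ} (hs : 0 ≤ s) (hsT : s ≤ T) (hR0 : 0 ≤ R) {z : EuclideanSpace ℝ (Fin n)}
    (hR : ∀ p ∈ P.processes s z, ∀ t, s ≤ t → ‖p.1 t‖ ≤ R)
    (hθ : 0 < θ) (hθ1 : θ < 1) (hb : 0 < b) (hc : 0 < c)
    (hpen : P.IsPenalty (fun t x => -Φ t x) T R θ b c) :
    ∃ p ∈ P.processes s z, ∫ r in s..T, P.runningCost p r ≤
      supConv (fun t x => -Φ t x) (T + 1) (R + 1) b c T (p.1 T) -
      supConv (fun t x => -Φ t x) (T + 1) (R + 1) b c s z + 5 * θ * (T - s) := by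
  have hT : 0 ≤ T := hs.trans hsT
  obtain ⟨h₀, hh₀, hstep⟩ := hΦ.exists_isArc_step hP hΩ hT hR0 hθ hθ1 hb hc hpen
  obtain ⟨N, hN⟩ := exists_nat_gt ((T - s) / h₀)
  have hN0 : (0 : ℝ) < N := lt_of_le_of_lt (div_nonneg (by linarith) hh₀.le) hN
  set h := (T - s) / N with hh
  have hhn : 0 ≤ h := div_nonneg (by linarith) hN0.le
  have hhh₀ : h ≤ h₀ := by
    rw [hh, div_le_iff₀ hN0]
    rw [div_lt_iff₀ hh₀] at hN
    linarith
  have hNh : N * h = T - s := by rw [hh]; field_simp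
  have key : ∀ k : ℕ, k ≤ N → ∃ p ∈ P.processes s z, ∫ r in s..s + k * h, P.runningCost p r ≤
      supConv (fun t x => -Φ t x) (T + 1) (R + 1) b c (s + k * h) (p.1 (s + k * h)) -
      supConv (fun t x => -Φ t x) (T + 1) (R + 1) b c s z + 5 * θ * (k * h) := by
    intro k
    induction k with
    | zero =>
      intro _
      obtain ⟨p, hp⟩ := hne s hs z
      refine ⟨p, hp, ?_⟩
      have hz : p.1 s = z := by simpa using (hp.2.1 s le_rfl).2
      simp [hz]
    | succ k ih =>
      intro hk
      obtain ⟨p, hp, hpe⟩ := ih (by omega)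
      set t := s + k * h with ht
      have hkh : 0 ≤ (k : ℝ) * h := by positivity
      have hst : s ≤ t := by linarith
      have htT : t ≤ T := by
        have : (k : ℝ) * h ≤ N * h := by gcongr; omega
        linarith
      have hsucc : s + ((k + 1 : ℕ) : ℝ) * h = t + h := by push_cast; rw [ht]; ring
      rw [hsucc]
      obtain ⟨a, ha, hae⟩ := hstep t ⟨hs.trans hst, htT⟩ (p.1 t) (hR p hp t hst) h hhn hhh₀
      -- An arbitrary tail, added only to have a process on the whole half-line; the next stage
      -- overwrites it.
      obtain ⟨e, he⟩ := hne (t + h) (by linarith) (a.1 (t + h))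
      have hq := ha.concat_mem_processes (by linarith) he
      have hpq := (isArc_of_mem_processes hp t).concat_mem_processes hst hq
      refine ⟨_, hpq, ?_⟩
      have hend : (concat t p (concat (t + h) a e)).1 (t + h) = a.1 (t + h) := by
        -- When T = s the step is zero, and the endpoint falls in the first piece of the
        -- concatenation.
        rcases hhn.eq_or_lt with h0 | h0
        · rw [← h0, add_zero, concat_fst_of_le le_rfl]
          have := (ha.trajectory t ⟨le_rfl, by linarith⟩).2
          simpa using this.symm
        · rw [concat_fst_of_lt (by linarith), concat_fst_of_le le_rfl]
      have hint : ∀ t₁ t₂, s ≤ t₁ → t₁ ≤ t₂ → IntervalIntegrable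
          (P.runningCost (concat t p (concat (t + h) a e))) volume t₁ t₂ := fun t₁ t₂ h₁ h₂ =>
        (intervalIntegrable_iff_integrableOn_Ioc_of_le h₂).2
          (hpq.2.2.mono_set fun r hr => lt_of_le_of_lt h₁ hr.1)
      rw [hend, ← intervalIntegral.integral_add_adjacent_intervals (hint s t le_rfl hst)
        (hint t (t + h) hst (by linarith)), integral_runningCost_concat_of_le hst,
        integral_runningCost_concat_of_ge (by linarith),
        integral_runningCost_concat_of_le (by linarith)]
      push_cast
      linarith
  obtain ⟨p, hp, hpe⟩ := key N le_rfl
  rw [hNh, add_sub_cancel] at hpe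
  exact ⟨p, hp, hpe⟩

lemma IsDiniSupersolution.value_le (hP : P.IsRegular K₁ K₂)
    (hΦ : P.IsDiniSupersolution Φ) (hΩ : P.Ω.Nonempty)
    (hne : ∀ τ : ℝ, 0 ≤ τ → ∀ z : EuclideanSpace ℝ (Fin n), (P.processes τ z).Nonempty)
    {s R : ℝ} (hs : 0 ≤ s) (hR0 : 0 ≤ R) {z : EuclideanSpace ℝ (Fin n)}
    (hR : ∀ p ∈ P.processes s z, ∀ t, s ≤ t → ‖p.1 t‖ ≤ R) : P.value s z ≤ Φ s z := by
  have hK₂ := hP.growth_pos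
  have hzR : ‖z‖ ≤ R := by
    obtain ⟨p, hp⟩ := hne s hs z
    have hz : p.1 s = z := by simpa using (hp.2.1 s le_rfl).2
    exact hz ▸ hR p hp s le_rfl
  refine le_of_forall_pos_le_add fun κ hκ => ?_
  obtain ⟨T, hsT, hTe, hTΦ⟩ := hΦ.decay.exists_horizon s (R + 1) (K₂ * (1 + R) / P.δ)
    hP.discount_pos (by positivity : 0 < κ / 3)
  have hsT' : 0 ≤ T - s := by linarith
  -- The factor 15 turns the accumulated error 5θ(T - s) into at most κ / 3.
  set θ := min (1 / 2) (κ / (15 * (T - s + 1))) with hθdef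
  have hθ : 0 < θ := by positivity
  have hθ1 : θ ≤ 1 / 2 := min_le_left _ _
  have hθκ : 5 * θ * (T - s) ≤ κ / 3 := by
    calc 5 * θ * (T - s) ≤ 5 * (κ / (15 * (T - s + 1))) * (T - s + 1) := by
          gcongr
          · exact min_le_right _ _
          · linarith
      _ = κ / 3 := by field_simp; norm_num
  obtain ⟨b, c, hb, hc, hpen⟩ := hP.exists_isPenalty (Ψ := fun t x => -Φ t x) hΦ.continuousOn_neg T R hθ
  obtain ⟨p, hp, hpe⟩ := hΦ.exists_process hP hΩ hne hs hsT hR0 hR hθ (by linarith) hb hc hpen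
  have hWs := le_supConv (Ψ := fun t x => -Φ t x) hΦ.continuousOn_neg b c (T := T + 1) (R := R + 1) (t := s) (y := z)
    (mem_timeCylinder_iff.2 ⟨⟨hs, by dsimp; linarith⟩, by dsimp; linarith⟩)
  have hWT : supConv (fun t x => -Φ t x) (T + 1) (R + 1) b c T (p.1 T) ≤ κ / 3 := by
    obtain ⟨q, hq, hqe, hmax⟩ := exists_supConv_eq (Ψ := fun t x => -Φ t x) hΦ.continuousOn_neg
      (by linarith : 0 ≤ T + 1) (by linarith : 0 ≤ R + 1) b c T (p.1 T)
    obtain ⟨h1, -, -⟩ := hpen T ⟨hs.trans hsT, le_rfl⟩ (p.1 T) (hR p hp T hsT) q hq hmax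
    have h2 := (abs_le.1 (hTΦ q.1 (by linarith [(abs_le.1 h1).1]) q.2
      (mem_timeCylinder_iff.1 hq).2)).1
    have h3 : 0 ≤ c / 2 * (q.1 - T) ^ 2 := by positivity
    have h4 : 0 ≤ b / 2 * ‖q.2 - p.1 T‖ ^ 2 := by positivity
    simp only [hqe, penalized]
    linarith
  have htail := (abs_le.1 (hP.abs_setIntegral_runningCost_le hs hp (hR p hp) hsT)).2
  have hcost := cost_eq_add hp hsT
  have hval : P.value s z ≤ P.cost s p := csInf_le (hP.bddBelow_cost hs hR) ⟨p, hp, rfl⟩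
  linarith

end Supersolution

/-- With no admissible control value, the half-line [s, ∞) would be a null set. -/
lemma nonempty_of_processes_nonempty {s : ℝ} {z : EuclideanSpace ℝ (Fin n)}
    (h : (P.processes s z).Nonempty) : P.Ω.Nonempty := by
  obtain ⟨p, hp⟩ := h
  by_contra hΩ
  rw [not_nonempty_iff_eq_empty] at hΩ
  have h1 : ∀ᵐ t : ℝ, ¬ s ≤ t := by
    simpa [hΩ] using ae_mem_of_mem_processes hp
  rw [ae_iff] at h1
  simp only [not_not] at h1
  change volume (Ici s) = 0 at h1
  simp at h1

end ControlProblem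

theorem proposition5p2 {n m : ℕ} (P : ControlProblem n m) (hδ : 0 < P.δ)
    (K₁ K₂ : ℝ) (hK₁ : 0 < K₁) (hK₂ : 0 < K₂)
    (A1 : ∀ t : ℝ, 0 ≤ t → ∀ u ∈ P.Ω, ∀ x z : EuclideanSpace ℝ (Fin n),
      |P.l t x u - P.l t z u| + ‖P.f t x u - P.f t z u‖ ≤ K₁ * ‖x - z‖)
    (A2 : ∀ t : ℝ, 0 ≤ t → ∀ x : EuclideanSpace ℝ (Fin n), ∀ u ∈ P.Ω,
      |P.l t x u| + ‖P.f t x u‖ ≤ K₂ * (1 + ‖x‖))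
    (A3_l : ContinuousOn
      (fun q : ℝ × EuclideanSpace ℝ (Fin n) × EuclideanSpace ℝ (Fin m) => P.l q.1 q.2.1 q.2.2)
      (Ici 0 ×ˢ univ))
    (A3_f : ContinuousOn
      (fun q : ℝ × EuclideanSpace ℝ (Fin n) × EuclideanSpace ℝ (Fin m) => P.f q.1 q.2.1 q.2.2)
      (Ici 0 ×ˢ univ))
    (A4 : ∀ t : ℝ, 0 ≤ t → ∀ x : EuclideanSpace ℝ (Fin n),
      Convex ℝ ((fun v => (Real.exp (-P.δ * t) * P.l t x v, P.f t x v)) '' P.Ω))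
    (A5 : IsCompact P.Ω)
    (A6 : ∀ τ : ℝ, 0 ≤ τ → ∀ z : EuclideanSpace ℝ (Fin n),
      ∃ S : Set (EuclideanSpace ℝ (Fin n)), Bornology.IsBounded S ∧
        ∀ p ∈ P.processes τ z, ∀ t : ℝ, τ ≤ t → p.1 t ∈ S)
    (hne : ∀ τ : ℝ, 0 ≤ τ → ∀ z : EuclideanSpace ℝ (Fin n), (P.processes τ z).Nonempty)
    (s : ℝ) (hs : 0 ≤ s) (z : EuclideanSpace ℝ (Fin n)) :
    IsGLB (P.cost s '' P.processes s z) (P.value s z) ∧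
    (∀ Φ : ℝ → EuclideanSpace ℝ (Fin n) → ℝ, P.IsDiniSubsolution Φ → Φ s z ≤ P.value s z) ∧
    (∀ Φ : ℝ → EuclideanSpace ℝ (Fin n) → ℝ, P.IsDiniSupersolution Φ → P.value s z ≤ Φ s z) := by
  have hP : P.IsRegular K₁ K₂ :=
    { discount_pos := hδ
      lipschitz_pos := hK₁
      growth_pos := hK₂
      lipschitz := fun t ht u hu x z => by
        linarith [A1 t ht u hu x z, abs_nonneg (P.l t x u - P.l t z u)]
      norm_f_le := fun t ht x u hu => by linarith [A2 t ht x u hu, abs_nonneg (P.l t x u)]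
      abs_l_le := fun t ht x u hu => by linarith [A2 t ht x u hu, norm_nonneg (P.f t x u)]
      continuousOn_l := A3_l
      continuousOn_f := A3_f
      isCompact := A5 }
  -- The bound at (s, z) alone suffices, since every process whose cost is estimated issues from (s,
  -- z).
  obtain ⟨S, hS, hpS⟩ := A6 s hs z
  obtain ⟨R, hR0, hSR⟩ := hS.exists_pos_norm_le
  have hR : ∀ p ∈ P.processes s z, ∀ t, s ≤ t → ‖p.1 t‖ ≤ R :=
    fun p hp t ht => hSR _ (hpS p hp t ht)
  refine ⟨isGLB_csInf ((hne s hs z).image _) (hP.bddBelow_cost hs hR), fun Φ hΦ => ?_,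
    fun Φ hΦ => hΦ.value_le hP (ControlProblem.nonempty_of_processes_nonempty (hne s hs z)) hne hs
      hR0.le hR⟩
  refine le_csInf ((hne s hs z).image _) ?_
  rintro _ ⟨p, hp, rfl⟩
  exact hΦ.le_cost hP hs hp (hR p hp)
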